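/- A digraph $X=(V,E)$ consists of a finite set $V$ and a set $E\subseteq\{(u,v)\in V\times V : u\neq v\}$. Put $n=|V|$. The complementary digraph $\overline X$ has vertex set $V$ and as edges exactly the pairs $(u,v)$ with $u\ne v$ and $(u,v)\notin E$. For a listing $\sigma=(\sigma_1,\dots,\sigma_n)$ of all vertices without repetition let $X\mathrm{Des}(\sigma)=\{1\le i\le n-1 : (\sigma_i,\sigma_{i+1})\in E\}$. The Redei-Berge symmetric function of $X$ is $$U_X=\sum_{\sigma}F_{X\mathrm{Des}(\sigma)},\qquad F_I=\sum_{\substack{1\le i_1\le i_2\le\cdots\le i_n\\ i_j<i_{j+1}\text{ for } j\in I}}x_{i_1}x_{i_2}\cdots x_{i_n}\quad(I\subseteq\{1,\dots,n-1\}),$$ where $\sigma$ runs over all listings of $V$. It is an element of the Hopf algebra $QSym$ of quasisymmetric functions over $\mathbb Q$, whose product is that of power series, whose comultiplication is $\Delta(M_{\alpha})=\sum_{\alpha=\beta\cdot\gamma}M_\beta\otimes M_\gamma$ (sum over all ways to write the composition $\alpha$ as a concatenation) on the monomial basis $M_{(a_1,\dots,a_k)}=\sum_{i_1<\cdots<i_k}x_{i_1}^{a_1}\cdots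 x_{i_k}^{a_k}$, and whose counit is the constant term. Let $S$ be the antipode of $QSym$. The Redei-Berge polynomial $u_X\in\mathbb Q[m]$ is the principal specialization of $U_X$: the unique polynomial with $u_X(m)=U_X(\underbrace{1,\dots,1}_{m},0,0,\dots)$ for all integers $m\ge 0$. A tournament is a digraph in which for any two distinct vertices $u,v$ exactly one of $(u,v)$ and $(v,u)$ is an edge. Let $X$ be a tournament on a vertex set $V$ with $n=|V|$. Then $$U_X=U_{\overline X},\qquad S(U_X)=(-1)^{n}\,U_X,\qquad u_X(-m)=(-1)^n\,u_X(m)\ \text{ as polynomials in } m.$$ -/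

import Mathlib

open scoped TensorProduct

noncomputable section

/-- The exponent vector of the monomial `x_{i₁}^{a₁} ⋯ x_{iₖ}^{aₖ}`, for lists `i` and `α = (a₁, …, aₖ)`
of equal length. A composition is a list of positive integers; the variables are `x₀, x₁, …`. -/
def monoExp (i : List ℕ) (α : List ℕ+) : ℕ →₀ ℕ :=
  (List.zipWith (fun p (a : ℕ+) => Finsupp.single p (a : ℕ)) i α).sum

/-- The formal sum `∑_{i : ι} x^{w i}` of monomials, for a family `w` with finite fibres. -/
def monoSum {ι : Type*} (w : ι → ℕ →₀ ℕ) : MvPowerSeries ℕ ℚ :=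
  fun d => (Nat.card {i : ι // w i = d} : ℚ)

/-- The coefficients of `x_{i₁}^{a₁} ⋯ x_{iₖ}^{aₖ}` and `x_{j₁}^{a₁} ⋯ x_{jₖ}^{aₖ}` agree for all
`i₁ < ⋯ < iₖ`, `j₁ < ⋯ < jₖ` and all positive exponents. -/
def IsQuasisymmetric (f : MvPowerSeries ℕ ℚ) : Prop :=
  ∀ (α : List ℕ+) (i j : List ℕ), i.length = α.length → j.length = α.length →
    i.Pairwise (· < ·) → j.Pairwise (· < ·) →
      MvPowerSeries.coeff (monoExp i α) f = MvPowerSeries.coeff (monoExp j α) f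

/-- The degrees of the monomials that occur in `f` are bounded. -/
def HasBoundedDegree (f : MvPowerSeries ℕ ℚ) : Prop :=
  ∃ N : ℕ, ∀ d : ℕ →₀ ℕ, N < d.degree → MvPowerSeries.coeff d f = 0

theorem monoExp_nil (α : List ℕ+) : monoExp [] α = 0 := by simp [monoExp]

theorem monoExp_cons (p : ℕ) (i : List ℕ) (a : ℕ+) (α : List ℕ+) :
    monoExp (p :: i) (a :: α) = Finsupp.single p (a : ℕ) + monoExp i α := by simp [monoExp]

theorem monoExp_append {i j : List ℕ} {α β : List ℕ+} (h : i.length = α.length) :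
    monoExp (i ++ j) (α ++ β) = monoExp i α + monoExp j β := by
  simp [monoExp, List.zipWith_append h]

theorem mapDomain_monoExp (φ : ℕ → ℕ) (i : List ℕ) (α : List ℕ+) :
    (monoExp i α).mapDomain φ = monoExp (i.map φ) α := by
  induction i generalizing α with
  | nil => simp [monoExp_nil]
  | cons p i ih =>
    cases α with
    | nil => simp [monoExp]
    | cons a α => simp [monoExp_cons, Finsupp.mapDomain_add, ih, Finsupp.mapDomain_single]

theorem degree_monoExp (i : List ℕ) (α : List ℕ+) (h : i.length = α.length) :
    (monoExp i α).degree = (α.map (fun a : ℕ+ => (a : ℕ))).sum := by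
  induction i generalizing α with
  | nil =>
    cases α with
    | nil => simp [monoExp_nil]
    | cons a α => simp at h
  | cons p i ih =>
    cases α with
    | nil => simp at h
    | cons a α => simp [monoExp_cons, ih α (by simpa using h)]

theorem monoExp_apply_eq_zero {i : List ℕ} {α : List ℕ+} {q : ℕ} (h : q ∉ i) :
    monoExp i α q = 0 := by
  induction i generalizing α with
  | nil => simp [monoExp_nil]
  | cons p i ih =>
    cases α with
    | nil => simp [monoExp]
    | cons a α =>
      simp only [List.mem_cons, not_or] at h
      simp [monoExp_cons, ih h.2, Ne.symm h.1]

theorem map_monoExp {i : List ℕ} {α : List ℕ+} (h : i.length = α.length) (hi : i.Nodup) :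
    i.map (monoExp i α) = α.map (fun a : ℕ+ => (a : ℕ)) := by
  induction i generalizing α with
  | nil =>
    cases α with
    | nil => simp
    | cons a α => simp at h
  | cons p i ih =>
    cases α with
    | nil => simp at h
    | cons a α =>
      have hp : p ∉ i := (List.nodup_cons.1 hi).1
      have := ih (α := α) (by simpa using h) (List.nodup_cons.1 hi).2
      simp only [List.map_cons, monoExp_cons, Finsupp.add_apply, Finsupp.single_eq_same,
        monoExp_apply_eq_zero hp, add_zero, ← this]
      congr 1
      apply List.map_congr_left
      intro q hq
      have : p ≠ q := by rintro rfl; exact hp hq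
      simp [this]

theorem mem_iff_monoExp {i : List ℕ} {α : List ℕ+} (h : i.length = α.length) (hi : i.Nodup)
    (q : ℕ) : q ∈ i ↔ monoExp i α q ≠ 0 := by
  constructor
  · intro hq
    have : monoExp i α q ∈ i.map (monoExp i α) := List.mem_map_of_mem hq
    rw [map_monoExp h hi] at this
    obtain ⟨a, -, ha⟩ := List.mem_map.1 this
    rw [← ha]; exact a.ne_zero
  · intro hq; by_contra hc; exact hq (monoExp_apply_eq_zero hc)

theorem sorted_nodup {i : List ℕ} (hi : i.Pairwise (· < ·)) : i.Nodup :=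
  hi.imp (fun h => ne_of_lt h)

theorem sorted_ext {i j : List ℕ} (hi : i.Pairwise (· < ·)) (hj : j.Pairwise (· < ·))
    (h : ∀ q, q ∈ i ↔ q ∈ j) : i = j :=
  ((List.perm_ext_iff_of_nodup (sorted_nodup hi) (sorted_nodup hj)).2 h).eq_of_pairwise
    (le := (· < ·)) (fun _ _ _ _ h1 h2 => absurd h1 (lt_asymm h2)) hi hj

theorem monoExp_inj {i j : List ℕ} {α β : List ℕ+} (h : i.length = α.length)
    (h' : j.length = β.length) (hi : i.Pairwise (· < ·)) (hj : j.Pairwise (· < ·))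
    (he : monoExp i α = monoExp j β) : i = j ∧ α = β := by
  have hij : i = j := sorted_ext hi hj fun q => by
    rw [mem_iff_monoExp h (sorted_nodup hi), mem_iff_monoExp h' (sorted_nodup hj), he]
  refine ⟨hij, ?_⟩
  have h1 := map_monoExp h (sorted_nodup hi)
  have h2 := map_monoExp h' (sorted_nodup hj)
  rw [he, hij, h2] at h1
  exact (List.map_injective_iff.2 PNat.coe_injective h1).symm

theorem exists_monoExp (d : ℕ →₀ ℕ) : ∃ (i : List ℕ) (α : List ℕ+),
    i.length = α.length ∧ i.Pairwise (· < ·) ∧ (∀ q ∈ i, q ∈ d.support) ∧ monoExp i α = d := by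
  induction d using Finsupp.induction_on_max₂ with
  | zero => exact ⟨[], [], by simp [monoExp_nil]⟩
  | add_single a b f hf hb ih =>
    obtain ⟨i, α, h1, h2, h3, h4⟩ := ih
    obtain ⟨c, rfl⟩ : ∃ c : ℕ+, (c : ℕ) = b := ⟨⟨b, Nat.pos_of_ne_zero hb⟩, rfl⟩
    refine ⟨i ++ [a], α ++ [c], by simp [h1], ?_, ?_, ?_⟩
    · rw [List.pairwise_append]
      exact ⟨h2, by simp, fun q hq r hr => by
        simp only [List.mem_singleton] at hr; subst hr; exact hf q (h3 q hq)⟩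
    · intro q hq
      simp only [List.mem_append, List.mem_singleton] at hq
      rcases hq with hq | rfl
      · have := h3 q hq
        simp only [Finsupp.mem_support_iff, Finsupp.add_apply] at this ⊢
        omega
      · simp
    · rw [monoExp_append h1, h4]; simp [monoExp]

theorem map_strictMono_sorted {φ : ℕ → ℕ} (hφ : StrictMono φ) {i : List ℕ}
    (hi : i.Pairwise (· < ·)) : (i.map φ).Pairwise (· < ·) :=
  List.Pairwise.map _ (fun _ _ h => hφ h) hi

theorem exists_strictMono {i : List ℕ} (hi : i.Pairwise (· < ·)) :
    ∃ φ : ℕ → ℕ, StrictMono φ ∧ i = (List.range i.length).map φ := by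
  refine ⟨fun t => if h : t < i.length then i[t] else i.sum + 1 + t, ?_, ?_⟩
  · intro s t hst
    by_cases ht : t < i.length
    · have hs : s < i.length := hst.trans ht
      simp only [hs, ht, dif_pos]
      exact List.pairwise_iff_getElem.1 hi s t hs ht hst
    · by_cases hs : s < i.length
      · simp only [hs, ht, dif_pos, dif_neg, not_false_eq_true]
        have := List.le_sum_of_mem (List.getElem_mem hs)
        omega
      · simp only [hs, ht, dif_neg, not_false_eq_true]; omega
  · apply List.ext_getElem
    · simp
    · intro n h1 h2; simp [h1]

theorem isQuasisymmetric_iff {f : MvPowerSeries ℕ ℚ} : IsQuasisymmetric f ↔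
    ∀ (φ : ℕ → ℕ), StrictMono φ → ∀ d : ℕ →₀ ℕ,
      MvPowerSeries.coeff (d.mapDomain φ) f = MvPowerSeries.coeff d f := by
  constructor
  · intro h φ hφ d
    obtain ⟨i, α, h1, h2, -, rfl⟩ := exists_monoExp d
    rw [mapDomain_monoExp]
    exact h α _ _ (by simpa using h1) h1 (map_strictMono_sorted hφ h2) h2
  · intro h α i j hi hj hi' hj'
    obtain ⟨φ, hφ, e1⟩ := exists_strictMono hi'
    obtain ⟨ψ, hψ, e2⟩ := exists_strictMono hj'
    rw [e1, e2, ← mapDomain_monoExp, ← mapDomain_monoExp, h φ hφ, h ψ hψ, hi, hj]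

theorem sum_antidiagonal_mapDomain {φ : ℕ → ℕ} (hφ : Function.Injective φ) (d : ℕ →₀ ℕ)
    (F : (ℕ →₀ ℕ) × (ℕ →₀ ℕ) → ℚ) :
    ∑ p ∈ Finset.HasAntidiagonal.antidiagonal (d.mapDomain φ), F p =
      ∑ p ∈ Finset.HasAntidiagonal.antidiagonal d, F (p.1.mapDomain φ, p.2.mapDomain φ) := by
  symm
  refine Finset.sum_bij (fun p _ => (p.1.mapDomain φ, p.2.mapDomain φ)) ?_ ?_ ?_ ?_
  · intro p hp
    rw [Finset.HasAntidiagonal.mem_antidiagonal] at hp ⊢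
    simp [← hp, Finsupp.mapDomain_add]
  · intro p _ q _ h
    simp only [Prod.mk.injEq] at h
    exact Prod.ext (Finsupp.mapDomain_injective hφ h.1) (Finsupp.mapDomain_injective hφ h.2)
  · intro p hp
    rw [Finset.HasAntidiagonal.mem_antidiagonal] at hp
    have key : ∀ q : ℕ →₀ ℕ, q ≤ d.mapDomain φ →
        (q.comapDomain φ hφ.injOn).mapDomain φ = q := by
      intro q hq
      apply Finsupp.mapDomain_comapDomain φ hφ
      intro x hx
      by_contra hc
      have h1 := hq x
      rw [Finsupp.mapDomain_of_notMem_range _ _ hc] at h1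
      simp at hx; omega
    have k1 := key p.1 (hp ▸ le_self_add)
    have k2 := key p.2 (hp ▸ le_add_self)
    refine ⟨(p.1.comapDomain φ hφ.injOn, p.2.comapDomain φ hφ.injOn), ?_, ?_⟩
    · rw [Finset.HasAntidiagonal.mem_antidiagonal]
      apply Finsupp.mapDomain_injective hφ
      simp only [Finsupp.mapDomain_add]
      rw [k1, k2, hp]
    · simp only; rw [k1, k2]
  · intro p _; rfl

/-- The algebra of quasisymmetric functions over `ℚ` in `x₀, x₁, x₂, …`. -/
def QSym : Subalgebra ℚ (MvPowerSeries ℕ ℚ) where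
  carrier := {f | HasBoundedDegree f ∧ IsQuasisymmetric f}
  add_mem' := by
    rintro f g ⟨⟨N, hN⟩, hf⟩ ⟨⟨K, hK⟩, hg⟩
    refine ⟨⟨N + K, fun d hd => ?_⟩, fun α i j h1 h2 h3 h4 => ?_⟩
    · rw [map_add, hN d (by omega), hK d (by omega), add_zero]
    · rw [map_add, map_add, hf α i j h1 h2 h3 h4, hg α i j h1 h2 h3 h4]
  mul_mem' := by
    classical
    rintro f g ⟨⟨N, hN⟩, hf⟩ ⟨⟨K, hK⟩, hg⟩
    refine ⟨⟨N + K, fun d hd => ?_⟩, ?_⟩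
    · rw [MvPowerSeries.coeff_mul]
      refine Finset.sum_eq_zero fun p hp => ?_
      rw [Finset.HasAntidiagonal.mem_antidiagonal] at hp
      have : p.1.degree + p.2.degree = d.degree := by rw [← hp, map_add]
      by_cases h : N < p.1.degree
      · rw [hN _ h, zero_mul]
      · rw [hK _ (by omega), mul_zero]
    · rw [isQuasisymmetric_iff] at hf hg ⊢
      intro φ hφ d
      rw [MvPowerSeries.coeff_mul, MvPowerSeries.coeff_mul,
        sum_antidiagonal_mapDomain hφ.injective]
      refine Finset.sum_congr rfl fun p _ => ?_
      simp only
      rw [hf φ hφ, hg φ hφ]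
  algebraMap_mem' := by
    classical
    intro r
    refine ⟨⟨0, fun d hd => ?_⟩, ?_⟩
    · rw [MvPowerSeries.algebraMap_apply, MvPowerSeries.coeff_C, if_neg]
      rintro rfl; simp at hd
    · rw [isQuasisymmetric_iff]
      intro φ hφ d
      rw [MvPowerSeries.algebraMap_apply, MvPowerSeries.coeff_C, MvPowerSeries.coeff_C]
      congr 1
      have := (Finsupp.mapDomain_injective (M := ℕ) hφ.injective).eq_iff (a := d) (b := 0)
      simpa using this

theorem monoSum_mem_QSym {ι : Type*} (w : ι → ℕ →₀ ℕ) (N : ℕ) (hN : ∀ i, (w i).degree ≤ N)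
    (h : ∀ (φ : ℕ → ℕ), StrictMono φ → ∀ d : ℕ →₀ ℕ,
      Nat.card {i : ι // w i = d.mapDomain φ} = Nat.card {i : ι // w i = d}) :
    monoSum w ∈ QSym := by
  refine ⟨⟨N, fun d hd => ?_⟩, isQuasisymmetric_iff.2 fun φ hφ d => ?_⟩
  · have : IsEmpty {i : ι // w i = d} := ⟨fun i => by
      have := hN i.1; rw [i.2] at this; omega⟩
    change (Nat.card {i : ι // w i = d} : ℚ) = 0
    simp
  · exact congrArg (Nat.cast (R := ℚ)) (h φ hφ d)

/-- `M_α = ∑_{i₁ < ⋯ < iₖ} x_{i₁}^{a₁} ⋯ x_{iₖ}^{aₖ}` as a power series. -/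
def monomialQSymSeries (α : List ℕ+) : MvPowerSeries ℕ ℚ :=
  monoSum (fun i : {i : List ℕ // i.length = α.length ∧ i.Pairwise (· < ·)} => monoExp i.1 α)

theorem coeff_monomialQSymSeries {i : List ℕ} {α β : List ℕ+} (h : i.length = β.length)
    (hi : i.Pairwise (· < ·)) :
    MvPowerSeries.coeff (monoExp i β) (monomialQSymSeries α) = if α = β then 1 else 0 := by
  change (Nat.card _ : ℚ) = _
  split_ifs with hαβ
  · subst hαβ
    have : Unique {j : {i : List ℕ // i.length = α.length ∧ i.Pairwise (· < ·)} //
        monoExp j.1 α = monoExp i α} :=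
      { default := ⟨⟨i, h, hi⟩, rfl⟩
        uniq := fun j => Subtype.ext (Subtype.ext (monoExp_inj j.1.2.1 h j.1.2.2 hi j.2).1) }
    simp
  · have : IsEmpty {j : {i : List ℕ // i.length = α.length ∧ i.Pairwise (· < ·)} //
        monoExp j.1 α = monoExp i β} :=
      ⟨fun j => hαβ (monoExp_inj j.1.2.1 h j.1.2.2 hi j.2).2⟩
    simp

namespace QSym

/-- The monomial quasisymmetric function `M_α`, for a composition `α`. -/
def M (α : List ℕ+) : QSym :=
  ⟨monomialQSymSeries α, by
    refine ⟨⟨(α.map (fun a : ℕ+ => (a : ℕ))).sum, fun d hd => ?_⟩, fun β i j h1 h2 h3 h4 => ?_⟩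
    · obtain ⟨i, β, h1, h2, -, rfl⟩ := exists_monoExp d
      rw [coeff_monomialQSymSeries h1 h2, if_neg]
      rintro rfl
      rw [degree_monoExp _ _ h1] at hd
      exact lt_irrefl _ hd
    · rw [coeff_monomialQSymSeries h1 h3, coeff_monomialQSymSeries h2 h4]⟩

/-- The coefficient functional of the monomial with exponent vector `d`. -/
def coeffL (d : ℕ →₀ ℕ) : QSym →ₗ[ℚ] ℚ := (MvPowerSeries.coeff d).comp QSym.val.toLinearMap

theorem coeffL_apply (d : ℕ →₀ ℕ) (f : QSym) :
    coeffL d f = MvPowerSeries.coeff d (f : MvPowerSeries ℕ ℚ) := rfl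

theorem coeffL_M {i : List ℕ} {α β : List ℕ+} (h : i.length = β.length)
    (hi : i.Pairwise (· < ·)) : coeffL (monoExp i β) (M α) = if α = β then 1 else 0 :=
  coeff_monomialQSymSeries h hi

/-- The exponent vector of `x₀^{a₁} ⋯ x_{k-1}^{aₖ}`. -/
def packed (α : List ℕ+) : ℕ →₀ ℕ := monoExp (List.range α.length) α

theorem coeffL_eq_packed {i : List ℕ} {β : List ℕ+} (h : i.length = β.length)
    (hi : i.Pairwise (· < ·)) (f : QSym) : coeffL (monoExp i β) f = coeffL (packed β) f :=
  f.2.2 β _ _ h (by simp) hi List.pairwise_lt_range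

theorem coeffL_packed_M (α β : List ℕ+) :
    coeffL (packed β) (M α) = if α = β then 1 else 0 :=
  coeffL_M (by simp) List.pairwise_lt_range

theorem ext_packed {f g : QSym} (h : ∀ α, coeffL (packed α) f = coeffL (packed α) g) : f = g := by
  apply Subtype.ext
  ext d
  obtain ⟨i, α, h1, h2, -, rfl⟩ := exists_monoExp d
  have := h α
  rwa [← coeffL_eq_packed h1 h2, ← coeffL_eq_packed h1 h2] at this

theorem finite_sum_le (N : ℕ) : {α : List ℕ+ | (α.map (fun a : ℕ+ => (a : ℕ))).sum ≤ N}.Finite := by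
  have h : ∀ n : ℕ, {α : List ℕ+ | (α.map (fun a : ℕ+ => (a : ℕ))).sum = n}.Finite := by
    intro n
    rw [← Set.finite_coe_iff]
    refine Finite.of_injective (β := Composition n) (fun α => ⟨α.1.map (fun a : ℕ+ => (a : ℕ)), by
      intro k hk; obtain ⟨a, -, rfl⟩ := List.mem_map.1 hk; exact a.pos, α.2⟩) ?_
    intro α β hαβ
    simp only [Composition.mk.injEq] at hαβ
    exact Subtype.ext (List.map_injective_iff.2 PNat.coe_injective hαβ)
  refine ((Set.finite_Iic N).biUnion (fun n _ => h n)).subset ?_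
  intro α hα
  simp only [Set.mem_iUnion]
  exact ⟨_, hα, rfl⟩

theorem finite_coeff (f : QSym) : {α | coeffL (packed α) f ≠ 0}.Finite := by
  obtain ⟨N, hN⟩ := f.2.1
  refine (finite_sum_le N).subset fun α hα => ?_
  by_contra hc
  apply hα
  apply hN
  rw [packed, degree_monoExp _ _ (by simp)]
  simpa using hc

/-- Coordinates of a quasisymmetric function in the monomial basis. -/
def coords : QSym →ₗ[ℚ] (List ℕ+ →₀ ℚ) where
  toFun f := Finsupp.ofSupportFinite (fun α => coeffL (packed α) f) (finite_coeff f)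
  map_add' f g := Finsupp.ext fun α => (coeffL (packed α)).map_add f g
  map_smul' r f := Finsupp.ext fun α => (coeffL (packed α)).map_smul r f

theorem coords_apply (f : QSym) (α : List ℕ+) : coords f α = coeffL (packed α) f := rfl

theorem coords_M (α : List ℕ+) : coords (M α) = Finsupp.single α 1 := by
  ext β; rw [coords_apply, coeffL_packed_M, Finsupp.single_apply]

/-- The monomial basis of `QSym`. -/
def basis : Module.Basis (List ℕ+) ℚ QSym :=
  Module.Basis.ofRepr (LinearEquiv.ofLinearMap coords (Finsupp.linearCombination ℚ M)
    (by ext α; simp [coords_M])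
    (by
      apply LinearMap.ext
      intro f
      apply ext_packed
      intro α
      rw [← coords_apply, ← coords_apply]
      have : coords.comp (Finsupp.linearCombination ℚ M) = LinearMap.id := by
        ext α; simp [coords_M]
      exact DFunLike.congr_fun (LinearMap.congr_fun this (coords f)) α))

theorem basis_apply (α : List ℕ+) : basis α = M α := by
  simp [basis]

theorem basis_repr (f : QSym) (α : List ℕ+) : basis.repr f α = coeffL (packed α) f := rfl


/-! ### Hopf algebra structure -/

theorem M_nil : M [] = 1 := by
  apply ext_packed
  intro β
  rw [coeffL_packed_M, coeffL_apply]
  change _ = MvPowerSeries.coeff (packed β) (1 : MvPowerSeries ℕ ℚ)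
  classical
  rw [MvPowerSeries.coeff_one]
  congr 1
  apply propext
  have hpn : packed [] = 0 := by simp [packed, monoExp_nil]
  constructor
  · rintro rfl; exact hpn
  · intro h
    rw [← hpn] at h
    exact ((monoExp_inj (by simp) (by simp) List.pairwise_lt_range List.pairwise_lt_range h).2).symm

/-- `Δ(M_α) = ∑_{α = β · γ} M_β ⊗ M_γ` (deconcatenation). -/
def comulL : QSym →ₗ[ℚ] QSym ⊗[ℚ] QSym :=
  basis.constr ℚ fun α => ∑ k ∈ Finset.range (α.length + 1), M (α.take k) ⊗ₜ[ℚ] M (α.drop k)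

theorem comulL_M (α : List ℕ+) :
    comulL (M α) = ∑ k ∈ Finset.range (α.length + 1), M (α.take k) ⊗ₜ[ℚ] M (α.drop k) := by
  rw [← basis_apply, comulL, Module.Basis.constr_basis]

/-- The constant term. -/
def counitL : QSym →ₗ[ℚ] ℚ := coeffL 0

theorem counitL_M (α : List ℕ+) : counitL (M α) = if α = [] then 1 else 0 := by
  have := coeffL_M (i := []) (α := α) (β := []) rfl List.Pairwise.nil
  rwa [monoExp_nil] at this

theorem hom_ext {A : Type*} [AddCommMonoid A] [Module ℚ A] {f g : QSym →ₗ[ℚ] A}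
    (h : ∀ α, f (M α) = g (M α)) : f = g :=
  basis.ext fun α => by rw [basis_apply]; exact h α

set_option synthInstance.maxHeartbeats 400000 in
instance instCoalgebra : Coalgebra ℚ QSym where
  comul := comulL
  counit := counitL
  coassoc := by
    refine hom_ext fun α => ?_
    simp only [LinearMap.coe_comp, Function.comp_apply, comulL_M, map_sum, LinearMap.rTensor_tmul,
      LinearMap.lTensor_tmul, TensorProduct.sum_tmul, TensorProduct.tmul_sum,
      LinearEquiv.coe_coe, TensorProduct.assoc_tmul]
    rw [Finset.sum_sigma', Finset.sum_sigma']
    refine Finset.sum_bij' (fun p _ => ⟨p.2, p.1 - p.2⟩) (fun p _ => ⟨p.1 + p.2, p.1⟩)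
      ?_ ?_ ?_ ?_ ?_
    · rintro ⟨a, b⟩ h
      simp only [Finset.mem_sigma, Finset.mem_range, List.length_take, List.length_drop] at h ⊢
      omega
    · rintro ⟨a, b⟩ h
      simp only [Finset.mem_sigma, Finset.mem_range, List.length_take, List.length_drop] at h ⊢
      omega
    · rintro ⟨a, b⟩ h
      simp only [Finset.mem_sigma, Finset.mem_range, List.length_take] at h ⊢
      have : b + (a - b) = a := by omega
      rw [this]
    · rintro ⟨a, b⟩ h
      simp
    · rintro ⟨a, b⟩ h
      simp only [Finset.mem_sigma, Finset.mem_range, List.length_take] at h ⊢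
      have h1 : b + (a - b) = a := by omega
      have h2 : min b a = b := by omega
      rw [List.take_take, List.drop_take, List.drop_drop, h1, h2]
  rTensor_counit_comp_comul := by
    refine hom_ext fun α => ?_
    simp only [LinearMap.coe_comp, Function.comp_apply, comulL_M, map_sum, LinearMap.rTensor_tmul,
      counitL_M]
    rw [Finset.sum_eq_single 0]
    · simp
    · intro k hk hk0
      rw [if_neg, TensorProduct.zero_tmul]
      simp only [Finset.mem_range] at hk
      intro h
      have := congrArg List.length h
      simp at this
      rcases this with h | rfl
      · exact hk0 h
      · simp at hk; exact hk0 hk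
    · simp
  lTensor_counit_comp_comul := by
    refine hom_ext fun α => ?_
    simp only [LinearMap.coe_comp, Function.comp_apply, comulL_M, map_sum, LinearMap.lTensor_tmul,
      counitL_M]
    rw [Finset.sum_eq_single α.length]
    · simp
    · intro k hk hk0
      rw [if_neg, TensorProduct.tmul_zero]
      simp only [Finset.mem_range] at hk
      intro h
      have := congrArg List.length h
      simp at this
      omega
    · simp

theorem comul_M (α : List ℕ+) : Coalgebra.comul (R := ℚ) (M α) =
    ∑ k ∈ Finset.range (α.length + 1), M (α.take k) ⊗ₜ[ℚ] M (α.drop k) := comulL_M α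

theorem counit_M (α : List ℕ+) :
    Coalgebra.counit (R := ℚ) (M α) = if α = [] then 1 else 0 := counitL_M α

/-- The coefficient functional of `x^d ⊗ x^e`. -/
def coeffL₂ (d e : ℕ →₀ ℕ) : QSym ⊗[ℚ] QSym →ₗ[ℚ] ℚ :=
  LinearMap.mul' ℚ ℚ ∘ₗ TensorProduct.map (coeffL d) (coeffL e)

theorem coeffL₂_tmul (d e : ℕ →₀ ℕ) (f g : QSym) :
    coeffL₂ d e (f ⊗ₜ g) = coeffL d f * coeffL e g := by simp [coeffL₂]

theorem ext₂ {x y : QSym ⊗[ℚ] QSym} (h : ∀ d e, coeffL₂ d e x = coeffL₂ d e y) : x = y := by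
  apply (basis.tensorProduct basis).repr.injective
  ext ⟨β, γ⟩
  have key : ∀ z : QSym ⊗[ℚ] QSym,
      (basis.tensorProduct basis).repr z (β, γ) = coeffL₂ (packed β) (packed γ) z := by
    intro z
    induction z with
    | zero => simp
    | add a b ha hb => simp [ha, hb]
    | tmul f g =>
      rw [coeffL₂_tmul, Module.Basis.tensorProduct_repr_tmul_apply, basis_repr, basis_repr,
        smul_eq_mul, mul_comm]
  rw [key, key, h]

theorem coeffL₂_comul (N : ℕ) (d e : ℕ →₀ ℕ) (hd : ∀ q ∈ d.support, q < N) (f : QSym) :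
    coeffL₂ d e (Coalgebra.comul (R := ℚ) f) = coeffL (d + e.mapDomain (· + N)) f := by
  suffices h : coeffL₂ d e ∘ₗ Coalgebra.comul (R := ℚ) = coeffL (d + e.mapDomain (· + N)) from
    LinearMap.congr_fun h f
  refine hom_ext fun α => ?_
  obtain ⟨i, β, h1, h2, h3, rfl⟩ := exists_monoExp d
  obtain ⟨j, γ, h4, h5, -, rfl⟩ := exists_monoExp e
  rw [mapDomain_monoExp, ← monoExp_append h1, coeffL_M (by simp [h1, h4])
    (List.pairwise_append.2 ⟨h2, map_strictMono_sorted (fun a b h => by simpa using h) h5, ?_⟩)]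
  · simp only [LinearMap.coe_comp, Function.comp_apply, comul_M, map_sum, coeffL₂_tmul,
      coeffL_M h1 h2, coeffL_M h4 h5]
    split_ifs with h
    · subst h
      rw [Finset.sum_eq_single β.length]
      · simp
      · intro k hk hne
        rw [if_neg, zero_mul]
        intro h
        have := congrArg List.length h
        simp at this hk
        omega
      · simp
    · refine Finset.sum_eq_zero fun k _ => ?_
      by_cases hb : α.take k = β
      · rw [if_neg (c := α.drop k = γ), mul_zero]
        intro hc
        exact h (by rw [← hb, ← hc, List.take_append_drop])
      · rw [if_neg hb, zero_mul]
  · intro a ha b hb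
    obtain ⟨c, -, rfl⟩ := List.mem_map.1 hb
    have := hd a (h3 a ha)
    omega

theorem coeffL_mul (d : ℕ →₀ ℕ) (f g : QSym) : coeffL d (f * g) =
    ∑ p ∈ Finset.HasAntidiagonal.antidiagonal d, coeffL p.1 f * coeffL p.2 g := by
  classical
  exact MvPowerSeries.coeff_mul _ _ _

theorem coeffL₂_mul (d e : ℕ →₀ ℕ) (x y : QSym ⊗[ℚ] QSym) : coeffL₂ d e (x * y) =
    ∑ p ∈ Finset.HasAntidiagonal.antidiagonal d, ∑ q ∈ Finset.HasAntidiagonal.antidiagonal e,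
      coeffL₂ p.1 q.1 x * coeffL₂ p.2 q.2 y := by
  induction x with
  | zero => simp
  | add a b ha hb => simp only [add_mul, map_add, ha, hb, Finset.sum_add_distrib]
  | tmul a b =>
    induction y with
    | zero => simp
    | add a b ha hb => simp only [mul_add, map_add, ha, hb, Finset.sum_add_distrib]
    | tmul f g =>
      simp only [Algebra.TensorProduct.tmul_mul_tmul, coeffL₂_tmul, coeffL_mul,
        Finset.sum_mul_sum]
      refine Finset.sum_congr rfl fun p _ => Finset.sum_congr rfl fun q _ => ?_
      ring

theorem sum_antidiagonal_add (N : ℕ) (d e : ℕ →₀ ℕ) (hd : ∀ q ∈ d.support, q < N)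
    (F : (ℕ →₀ ℕ) → (ℕ →₀ ℕ) → ℚ) :
    ∑ p ∈ Finset.HasAntidiagonal.antidiagonal (d + e.mapDomain (· + N)), F p.1 p.2 =
      ∑ p ∈ Finset.HasAntidiagonal.antidiagonal d, ∑ q ∈ Finset.HasAntidiagonal.antidiagonal e,
        F (p.1 + q.1.mapDomain (· + N)) (p.2 + q.2.mapDomain (· + N)) := by
  classical
  have hinj : Function.Injective (fun x : ℕ => x + N) := add_left_injective N
  have lo : ∀ (a b : ℕ →₀ ℕ) (x : ℕ), x < N → (a + b.mapDomain (· + N)) x = a x := by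
    intro a b x hx
    rw [Finsupp.add_apply, Finsupp.mapDomain_of_notMem_range, add_zero]
    rintro ⟨y, hy⟩; simp only at hy; omega
  have hi : ∀ (a b : ℕ →₀ ℕ) (x : ℕ), (∀ q ∈ a.support, q < N) →
      (a + b.mapDomain (· + N)) (x + N) = b x := by
    intro a b x ha
    have : a (x + N) = 0 := by
      by_contra hc
      have := ha _ (Finsupp.mem_support_iff.2 hc)
      omega
    rw [Finsupp.add_apply, this, zero_add, Finsupp.mapDomain_apply hinj]
  have hsub : ∀ a : ℕ →₀ ℕ, a ≤ d → ∀ q ∈ a.support, q < N := by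
    intro a ha q hq
    refine hd q (Finsupp.mem_support_iff.2 ?_)
    have := ha q
    have := Finsupp.mem_support_iff.1 hq
    omega
  have dec : ∀ a : ℕ →₀ ℕ, a = a.filter (· < N) +
      (a.comapDomain (· + N) hinj.injOn).mapDomain (· + N) := by
    intro a
    ext x
    by_cases hx : x < N
    · rw [lo _ _ _ hx, Finsupp.filter_apply_pos (fun x => x < N) _ hx]
    · obtain ⟨y, rfl⟩ : ∃ y, x = y + N := ⟨x - N, by omega⟩
      rw [hi _ _ _ (by intro q hq; simp at hq; exact hq.2), Finsupp.comapDomain_apply]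
  rw [← Finset.sum_product']
  symm
  refine Finset.sum_bij (fun r _ => (r.1.1 + r.2.1.mapDomain (· + N),
    r.1.2 + r.2.2.mapDomain (· + N))) ?_ ?_ ?_ ?_
  · rintro ⟨⟨a, b⟩, ⟨u, v⟩⟩ h
    simp only [Finset.mem_product, Finset.HasAntidiagonal.mem_antidiagonal] at h ⊢
    rw [← h.1, ← h.2, Finsupp.mapDomain_add]
    abel
  · rintro ⟨⟨a, b⟩, ⟨u, v⟩⟩ h ⟨⟨a', b'⟩, ⟨u', v'⟩⟩ h' he
    simp only [Finset.mem_product, Finset.HasAntidiagonal.mem_antidiagonal] at h h'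
    have ha := hsub a (h.1 ▸ le_self_add)
    have hb := hsub b (h.1 ▸ le_add_self)
    have ha' := hsub a' (h'.1 ▸ le_self_add)
    have hb' := hsub b' (h'.1 ▸ le_add_self)
    have key : ∀ a a' u u' : ℕ →₀ ℕ, (∀ q ∈ a.support, q < N) → (∀ q ∈ a'.support, q < N) →
        a + u.mapDomain (· + N) = a' + u'.mapDomain (· + N) → a = a' ∧ u = u' := by
      intro a a' u u' ha ha' he
      constructor
      · ext x
        by_cases hx : x < N
        · rw [← lo a u x hx, he, lo _ _ _ hx]
        · have z : ∀ c : ℕ →₀ ℕ, (∀ q ∈ c.support, q < N) → c x = 0 := by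
            intro c hc
            by_contra hne
            exact hx (hc x (Finsupp.mem_support_iff.2 hne))
          rw [z a ha, z a' ha']
      · ext x
        rw [← hi a u x ha, he, hi _ _ _ ha']
    simp only [Prod.mk.injEq] at he
    obtain ⟨e1, e2⟩ := key _ _ _ _ ha ha' he.1
    obtain ⟨e3, e4⟩ := key _ _ _ _ hb hb' he.2
    rw [e1, e2, e3, e4]
  · rintro ⟨a, b⟩ h
    rw [Finset.HasAntidiagonal.mem_antidiagonal] at h
    simp only at h
    refine ⟨((a.filter (· < N), b.filter (· < N)), (a.comapDomain (· + N) hinj.injOn,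
      b.comapDomain (· + N) hinj.injOn)), ?_, ?_⟩
    · simp only [Finset.mem_product, Finset.HasAntidiagonal.mem_antidiagonal]
      constructor
      · ext x
        by_cases hx : x < N
        · rw [← lo d e x hx, ← h]
          simp [hx]
        · have : d x = 0 := by
            by_contra hne
            exact hx (hd x (Finsupp.mem_support_iff.2 hne))
          simp [hx, this]
      · ext x
        rw [← hi d e x hd, ← h]
        simp
    · simp only
      rw [← dec a, ← dec b]
  · intros; rfl

instance instBialgebra : Bialgebra ℚ QSym :=
  Bialgebra.mk' ℚ QSym
    (by rw [← M_nil, counit_M, if_pos rfl])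
    (by
      intro a b
      change coeffL 0 (a * b) = coeffL 0 a * coeffL 0 b
      rw [coeffL_mul]
      simp)
    (by
      rw [← M_nil, comul_M]
      simp [M_nil, Algebra.TensorProduct.one_def])
    (by
      intro f g
      apply ext₂
      intro d e
      obtain ⟨N, hN⟩ : ∃ N, ∀ q ∈ d.support, q < N :=
        ⟨d.support.sup id + 1, fun q hq => Nat.lt_succ_of_le (Finset.le_sup (f := id) hq)⟩
      rw [coeffL₂_comul N d e hN, coeffL_mul,
        sum_antidiagonal_add N d e hN (fun a b => coeffL a f * coeffL b g), coeffL₂_mul]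
      refine Finset.sum_congr rfl fun p hp => Finset.sum_congr rfl fun q _ => ?_
      rw [Finset.HasAntidiagonal.mem_antidiagonal] at hp
      have hsub : ∀ a : ℕ →₀ ℕ, a ≤ d → ∀ q ∈ a.support, q < N := by
        intro a ha q hq
        refine hN q (Finsupp.mem_support_iff.2 ?_)
        have := ha q
        have := Finsupp.mem_support_iff.1 hq
        omega
      rw [coeffL₂_comul N _ _ (hsub _ (hp ▸ le_self_add)),
        coeffL₂_comul N _ _ (hsub _ (hp ▸ le_add_self))])

/-- `S(M_α)`, by the recursion `∑_{α = β · γ} S(M_β) M_γ = 0` for `α ≠ ∅`. -/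
def antipodeM (α : List ℕ+) : QSym :=
  if α = [] then 1
  else -∑ k : Fin α.length, antipodeM (α.take k) * M (α.drop k)
termination_by α.length
decreasing_by simp

/-- The recursion `∑_{α = β · γ} M_β T(M_γ) = 0` for a right convolution inverse. -/
def rightAntipodeM (α : List ℕ+) : QSym :=
  if α = [] then 1
  else -∑ k : Fin α.length, M (α.take (k + 1)) * rightAntipodeM (α.drop (k + 1))
termination_by α.length
decreasing_by
  have := k.2
  rw [List.length_drop]
  omega

theorem antipodeM_nil : antipodeM [] = 1 := by rw [antipodeM, if_pos rfl]

theorem antipodeM_of_ne {α : List ℕ+} (h : α ≠ []) : antipodeM α =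
    -∑ k : Fin α.length, antipodeM (α.take k) * M (α.drop k) := by rw [antipodeM, if_neg h]

theorem rightAntipodeM_nil : rightAntipodeM [] = 1 := by rw [rightAntipodeM, if_pos rfl]

theorem rightAntipodeM_of_ne {α : List ℕ+} (h : α ≠ []) : rightAntipodeM α =
    -∑ k : Fin α.length, M (α.take (k + 1)) * rightAntipodeM (α.drop (k + 1)) := by
  rw [rightAntipodeM, if_neg h]

/-- The antipode of `QSym`. -/
def antipodeL : QSym →ₗ[ℚ] QSym := basis.constr ℚ antipodeM

theorem antipodeL_M (α : List ℕ+) : antipodeL (M α) = antipodeM α := by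
  rw [← basis_apply, antipodeL, Module.Basis.constr_basis]

theorem mul_antipodeL_rTensor : LinearMap.mul' ℚ QSym ∘ₗ antipodeL.rTensor QSym ∘ₗ
    Coalgebra.comul = Algebra.linearMap ℚ QSym ∘ₗ Coalgebra.counit := by
  refine hom_ext fun α => ?_
  simp only [LinearMap.coe_comp, Function.comp_apply, comul_M, map_sum, LinearMap.rTensor_tmul,
    counit_M, LinearMap.mul'_apply, antipodeL_M]
  by_cases h : α = []
  · subst h
    simp [antipodeM_nil, M_nil]
  · rw [if_neg h, map_zero, Finset.sum_range_succ, Finset.sum_range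
      (fun k => antipodeM (α.take k) * M (α.drop k)), List.take_length, List.drop_length, M_nil,
      mul_one]
    rw [antipodeM_of_ne h, add_neg_cancel]

theorem mul_antipodeL_lTensor : LinearMap.mul' ℚ QSym ∘ₗ antipodeL.lTensor QSym ∘ₗ
    Coalgebra.comul = Algebra.linearMap ℚ QSym ∘ₗ Coalgebra.counit := by
  let T : QSym →ₗ[ℚ] QSym := basis.constr ℚ rightAntipodeM
  have hT : ∀ α, T (M α) = rightAntipodeM α := fun α => by
    rw [← basis_apply]; exact Module.Basis.constr_basis _ _ _ _
  have h1 : WithConv.toConv antipodeL * WithConv.toConv (LinearMap.id : QSym →ₗ[ℚ] QSym) = 1 := by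
    rw [LinearMap.convMul_def, LinearMap.convOne_def]
    exact congrArg WithConv.toConv mul_antipodeL_rTensor
  have h2 : WithConv.toConv (LinearMap.id : QSym →ₗ[ℚ] QSym) * WithConv.toConv T = 1 := by
    rw [LinearMap.convMul_def, LinearMap.convOne_def]
    refine congrArg WithConv.toConv (hom_ext fun α => ?_)
    simp only [LinearMap.coe_comp, Function.comp_apply, comul_M, map_sum, TensorProduct.map_tmul,
      counit_M, LinearMap.mul'_apply, hT, LinearMap.id_apply]
    by_cases h : α = []
    · subst h
      simp [rightAntipodeM_nil, M_nil]
    · rw [if_neg h, Finset.sum_range_succ', Finset.sum_range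
        (fun k => M (α.take (k + 1)) * rightAntipodeM (α.drop (k + 1))), List.take_zero,
        List.drop_zero, M_nil, one_mul]
      rw [rightAntipodeM_of_ne h, add_neg_cancel, map_zero]
  have h3 := left_inv_eq_right_inv h1 h2
  rw [← h3, LinearMap.convMul_def, LinearMap.convOne_def] at h2
  exact WithConv.toConv_injective h2

instance instHopfAlgebra : HopfAlgebra ℚ QSym where
  antipode := antipodeL
  mul_antipode_rTensor_comul := mul_antipodeL_rTensor
  mul_antipode_lTensor_comul := mul_antipodeL_lTensor


/-! ### Fundamental quasisymmetric functions -/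

/-- `F_I = ∑ x_{i₁} ⋯ x_{iₙ}` over `i₁ ≤ ⋯ ≤ iₙ` with `i_j < i_{j+1}` for `j ∈ I`. Positions are
numbered from `0`, so that `I ⊆ {0, …, n - 2}` stands for the subset `I + 1` of `[n - 1]`. -/
def F (n : ℕ) (I : Set ℕ) : QSym :=
  ⟨monoSum (fun i : {i : Fin n → ℕ // Monotone i ∧
      ∀ (j : ℕ) (h : j + 1 < n), j ∈ I → i ⟨j, by omega⟩ < i ⟨j + 1, h⟩} =>
    ∑ t, Finsupp.single (i.1 t) 1), by
    refine monoSum_mem_QSym _ n (fun i => by simp) fun φ hφ d => ?_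
    symm
    refine Nat.card_eq_of_bijective
      (fun i => ⟨⟨φ ∘ i.1.1, hφ.monotone.comp i.1.2.1, fun j h hj => hφ (i.1.2.2 j h hj)⟩, by
        refine Eq.trans ?_ (congrArg (Finsupp.mapDomain φ) i.2)
        simp [Finsupp.mapDomain_finsetSum, Finsupp.mapDomain_single]⟩) ⟨?_, ?_⟩
    · rintro ⟨⟨i, hi⟩, hi'⟩ ⟨⟨j, hj⟩, hj'⟩ h
      simp only [Subtype.mk.injEq] at h ⊢
      exact hφ.injective.comp_left h
    · rintro ⟨⟨i, hi1, hi2⟩, hi'⟩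
      simp only at hi'
      have hr : ∀ t, ∃ x, φ x = i t := by
        intro t
        by_contra hc
        have h0 : d.mapDomain φ (i t) = 0 := Finsupp.mapDomain_of_notMem_range _ _ hc
        rw [← hi', Finsupp.finsetSum_apply, Finset.sum_eq_zero_iff] at h0
        simpa using h0 t (Finset.mem_univ t)
      choose k hk using hr
      obtain rfl : i = φ ∘ k := funext fun t => (hk t).symm
      refine ⟨⟨⟨k, fun s t h => hφ.le_iff_le.1 (hi1 h), fun j h hj => hφ.lt_iff_lt.1 (hi2 j h hj)⟩,
        ?_⟩, rfl⟩
      apply Finsupp.mapDomain_injective hφ.injective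
      rw [← hi']
      simp [Finsupp.mapDomain_finsetSum, Finsupp.mapDomain_single]⟩

/-! ### Principal specialization -/

/-- The value `Φ(1, …, 1, 0, 0, …)` with `m` ones: the (finite) sum of the coefficients of all
monomials in the first `m` variables. -/
def evalOnes (m : ℕ) (Φ : QSym) : ℚ :=
  ∑ᶠ d ∈ {d : ℕ →₀ ℕ | d.support ⊆ Finset.range m},
    MvPowerSeries.coeff d (Φ : MvPowerSeries ℕ ℚ)

theorem finite_evalOnes (m : ℕ) (Φ : QSym) : ({d : ℕ →₀ ℕ | d.support ⊆ Finset.range m} ∩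
    Function.support fun d => MvPowerSeries.coeff d (Φ : MvPowerSeries ℕ ℚ)).Finite := by
  obtain ⟨N, hN⟩ := Φ.2.1
  refine (Set.finite_Iic (∑ p ∈ Finset.range m, Finsupp.single p N)).subset ?_
  rintro d ⟨h1, h2⟩ p
  rw [Finsupp.finsetSum_apply]
  by_cases hp : p ∈ d.support
  · have hdN : d.degree ≤ N := by
      by_contra hc
      exact h2 (hN d (not_le.1 hc))
    have : d p ≤ d.degree := Finset.single_le_sum (f := d) (fun _ _ => Nat.zero_le _) hp
    have h3 : N = ∑ q ∈ Finset.range m, Finsupp.single q N p := by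
      rw [Finset.sum_eq_single p]
      · simp
      · intro b _ hb; simp [hb]
      · intro h; exact absurd (h1 hp) h
    omega
  · rw [Finsupp.notMem_support_iff.1 hp]; exact Nat.zero_le _

theorem evalOnes_M (m : ℕ) (α : List ℕ+) : evalOnes m (M α) = (m.choose α.length : ℚ) := by
  classical
  have hco : ∀ d : ℕ →₀ ℕ, MvPowerSeries.coeff d (M α : MvPowerSeries ℕ ℚ) =
      if (∃ i : List ℕ, i.length = α.length ∧ i.Pairwise (· < ·) ∧ monoExp i α = d)
        then 1 else 0 := by
    intro d
    obtain ⟨i, β, h1, h2, -, rfl⟩ := exists_monoExp d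
    rw [← coeffL_apply, coeffL_M h1 h2]
    congr 1
    apply propext
    constructor
    · rintro rfl; exact ⟨i, h1, h2, rfl⟩
    · rintro ⟨j, h3, h4, h5⟩; exact (monoExp_inj h3 h1 h4 h2 h5).2
  have hfin : ∀ s : Finset ℕ, s.card = α.length →
      (s.sort (· ≤ ·)).length = α.length ∧ (s.sort (· ≤ ·)).Pairwise (· < ·) := fun s hs =>
    ⟨by simpa using hs, (Finset.sortedLT_sort s).pairwise⟩
  have hsupp : ∀ s : Finset ℕ, s.card = α.length → (monoExp (s.sort (· ≤ ·)) α).support = s := by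
    intro s hs
    ext q
    rw [Finsupp.mem_support_iff, ← mem_iff_monoExp (hfin s hs).1 (sorted_nodup (hfin s hs).2)]
    simp
  rw [evalOnes, show m.choose α.length =
    (Finset.powersetCard α.length (Finset.range m)).card by simp]
  rw [finsum_mem_eq_sum_of_inter_support_eq (t := (Finset.powersetCard α.length (Finset.range m)).image
    (fun s => monoExp (s.sort (· ≤ ·)) α))]
  · rw [Finset.sum_image, Finset.card_eq_sum_ones, Nat.cast_sum]
    · refine Finset.sum_congr rfl fun s hs => ?_
      have hs := hfin s (Finset.mem_powersetCard.1 hs).2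
      rw [hco, if_pos ⟨_, hs.1, hs.2, rfl⟩, Nat.cast_one]
    · intro s hs t ht h
      rw [Finset.mem_coe, Finset.mem_powersetCard] at hs ht
      rw [← hsupp s hs.2, ← hsupp t ht.2]
      exact congrArg Finsupp.support h
  · ext d
    simp only [Set.mem_inter_iff, Set.mem_ofPred_eq, Function.mem_support, hco, Finset.coe_image,
      Set.mem_image, Finset.mem_coe, Finset.mem_powersetCard]
    constructor
    · rintro ⟨h1, h2⟩
      refine ⟨?_, h2⟩
      obtain ⟨i, h3, h4, rfl⟩ : ∃ i : List ℕ, i.length = α.length ∧ i.Pairwise (· < ·) ∧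
          monoExp i α = d := by by_contra hc; simp [hc] at h2
      have hi : i.toFinset = (monoExp i α).support := by
        ext q
        rw [List.mem_toFinset, mem_iff_monoExp h3 (sorted_nodup h4), Finsupp.mem_support_iff]
      have hc : i.toFinset.card = α.length := by
        rw [List.toFinset_card_of_nodup (sorted_nodup h4), h3]
      refine ⟨i.toFinset, ⟨hi ▸ h1, hc⟩, ?_⟩
      have : i.toFinset.sort (· ≤ ·) = i :=
        sorted_ext (hfin _ hc).2 h4 (by simp)
      simp only [this]
    · rintro ⟨⟨s, ⟨h1, h2⟩, rfl⟩, h3⟩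
      refine ⟨?_, h3⟩
      rwa [hsupp s h2]

theorem existsUnique_polynomial (Φ : QSym) :
    ∃! p : Polynomial ℚ, ∀ m : ℕ, p.eval (m : ℚ) = evalOnes m Φ := by
  let P : QSym →ₗ[ℚ] Polynomial ℚ := basis.constr ℚ fun α =>
    Polynomial.C ((α.length.factorial : ℚ)⁻¹) * descPochhammer ℚ α.length
  have hP : ∀ α, P (M α) =
      Polynomial.C ((α.length.factorial : ℚ)⁻¹) * descPochhammer ℚ α.length := fun α => by
    rw [← basis_apply]; exact Module.Basis.constr_basis _ _ _ _
  have key : ∀ m : ℕ, (P Φ).eval (m : ℚ) = evalOnes m Φ := by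
    intro m
    let E : QSym →ₗ[ℚ] ℚ :=
      { toFun := evalOnes m
        map_add' := fun f g => by
          simp only [evalOnes, Subalgebra.coe_add, map_add]
          exact finsum_mem_add_distrib' (finite_evalOnes m f) (finite_evalOnes m g)
        map_smul' := fun r f => by
          simp only [evalOnes, Subalgebra.coe_smul, map_smul, RingHom.id_apply]
          exact (mul_finsum_mem _ r).symm }
    have : (Polynomial.leval (m : ℚ)) ∘ₗ P = E := by
      refine hom_ext fun α => ?_
      change (P (M α)).eval (m : ℚ) = evalOnes m (M α)
      rw [hP, evalOnes_M, Polynomial.eval_mul, Polynomial.eval_C,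
        descPochhammer_eval_eq_descFactorial, Nat.descFactorial_eq_factorial_mul_choose,
        Nat.cast_mul, inv_mul_cancel_left₀ (by positivity)]
    exact LinearMap.congr_fun this Φ
  refine ⟨P Φ, key, fun q hq => ?_⟩
  apply Polynomial.eq_of_infinite_eval_eq
  refine (Set.infinite_range_of_injective (Nat.cast_injective (R := ℚ))).mono ?_
  rintro _ ⟨m, rfl⟩
  exact (hq m).trans (key m).symm

/-- The principal specialization `ps¹(Φ)`: the polynomial in `m` with
`ps¹(Φ)(m) = Φ(1, …, 1, 0, 0, …)` (`m` ones). -/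
def psOne (Φ : QSym) : Polynomial ℚ := (existsUnique_polynomial Φ).choose

theorem psOne_eval (Φ : QSym) (m : ℕ) : (psOne Φ).eval (m : ℚ) = evalOnes m Φ :=
  (existsUnique_polynomial Φ).choose_spec.1 m

end QSym

namespace Digraph

variable {V : Type*}

/-- The descent set of a listing `σ = (σ₀, …, σ_{n-1})` of the vertices, positions being numbered
from `0`. -/
def desSet {n : ℕ} (X : Digraph V) (σ : Fin n → V) : Set ℕ :=
  {j | ∃ h : j + 1 < n, X.Adj (σ ⟨j, by omega⟩) (σ ⟨j + 1, h⟩)}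

open Classical in
/-- The Redei-Berge symmetric function `U_X = ∑_σ F_{XDes(σ)}`, over all listings `σ` of the
vertices. -/
def redeiBerge [Fintype V] (X : Digraph V) : QSym :=
  ∑ σ : Fin (Fintype.card V) ≃ V, QSym.F (Fintype.card V) (X.desSet σ)

/-- The Redei-Berge polynomial `u_X = ps¹(U_X)`. -/
def redeiBergePoly [Fintype V] (X : Digraph V) : Polynomial ℚ := QSym.psOne X.redeiBerge

/-- The complementary digraph in the setting of digraphs without loops: its edges are the pairs
`(u, v)` with `u ≠ v` that are not edges of `X`. -/
def complementary (X : Digraph V) : Digraph V where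
  Adj u v := u ≠ v ∧ ¬ X.Adj u v

/-- A tournament: no loops, and for distinct `u`, `v` exactly one of `(u, v)`, `(v, u)` is an
edge. -/
def IsTournament (X : Digraph V) : Prop :=
  (∀ v, ¬ X.Adj v v) ∧ ∀ u v, u ≠ v → (X.Adj u v ↔ ¬ X.Adj v u)

end Digraph

end

/-!
The coefficient of `x^d` in `U_X` counts the pairs of a weakly increasing word `i` of content `d` and
a listing `σ` of the vertices such that no edge `(σ_j, σ_{j+1})` of `X` joins two positions with the
same letter: inside each block of equal letters, `σ` steps along non-edges only. Reversing `σ` inside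
every block (`blockReverse`) turns such a pair for `X` into one for the opposite digraph, and for a
tournament the opposite digraph is the complementary one. This proves `U_X = U_{X̄}`.

For the antipode, `S(F_I) = (-1)ⁿ F_J` with `J` the reversed complement of `I` (`QSym.antipode_F`).
By `Δ(F_I) = ∑ₖ F_{I'} ⊗ F_{I''}` (`QSym.comul_F`), where the summand for `k` cuts the words of length
`n` after `k` letters, this amounts to an alternating sum over `k` of products being zero
(`QSym.sum_neg_one_pow_F_mul_F`). A product of two such fundamental functions enumerates words that
step down before the cut and up after it; moving the cut across the pair of letters astride it
cancels the terms in pairs (`sum_neg_one_pow_cuts`). Reading listings backwards then turns `S(U_X)`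
into `(-1)ⁿ` times the function of the opposite of the complementary digraph, which for a tournament
is `X` itself.

Finally, `ps¹(S(Φ))(m) = ps¹(Φ)(-m)` for every quasisymmetric `Φ` (`QSym.psOne_eval_neg`): evaluation at
`m` ones is multiplicative, `ps¹(M_α)(m) = C(m, ℓ(α))`, and the recursion for `S(M_α)` becomes the
Chu-Vandermonde identity for `C(-m + m, ℓ)`.
-/

noncomputable section

/-! ### Words and their contents -/

/-- The content of a word `i` over the alphabet `ℕ`: the exponent vector of `x_{i₀} ⋯ x_{i_{n-1}}`. -/
def wordContent {n : ℕ} (i : Fin n → ℕ) : ℕ →₀ ℕ := ∑ t, Finsupp.single (i t) 1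

theorem wordContent_apply {n : ℕ} (i : Fin n → ℕ) (q : ℕ) :
    wordContent i q = (Finset.univ.filter fun t => i t = q).card := by
  rw [wordContent, Finsupp.finsetSum_apply, Finset.card_filter]
  simp [Finsupp.single_apply]

theorem degree_wordContent {n : ℕ} (i : Fin n → ℕ) : (wordContent i).degree = n := by
  simp [wordContent]

theorem mem_support_wordContent {n : ℕ} (i : Fin n → ℕ) (t : Fin n) :
    i t ∈ (wordContent i).support := by
  rw [Finsupp.mem_support_iff, wordContent_apply]
  exact (Finset.card_pos.2 ⟨t, by simp⟩).ne'

theorem card_filter_lt {n : ℕ} (i : Fin n → ℕ) (p : ℕ) :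
    (Finset.univ.filter fun t => i t < p).card = ∑ q ∈ Finset.range p, wordContent i q := by
  rw [Finset.card_eq_sum_card_fiberwise (f := i) (t := Finset.range p) (by intro t; simp)]
  refine Finset.sum_congr rfl fun q hq => ?_
  rw [wordContent_apply, Finset.filter_filter]
  congr 1
  ext t
  simp only [Finset.mem_filter, Finset.mem_univ, true_and, and_iff_right_iff_imp]
  rintro rfl
  exact Finset.mem_range.1 hq

/-- The letters less than `p` of a weakly increasing word occupy an initial segment of positions,
whose length is a partial sum of the content. -/
theorem lt_iff_lt_sum_wordContent {n : ℕ} {i : Fin n → ℕ} (hi : Monotone i) (t : Fin n) (p : ℕ) :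
    i t < p ↔ (t : ℕ) < ∑ q ∈ Finset.range p, wordContent i q := by
  rw [← card_filter_lt]
  constructor
  · intro h
    have := Finset.card_le_card (s := Finset.Iic t) (t := Finset.univ.filter fun s => i s < p)
      fun s hs => by simpa using (hi (Finset.mem_Iic.1 hs)).trans_lt h
    rw [Fin.card_Iic] at this
    omega
  · intro h
    by_contra hc
    have := Finset.card_le_card (t := Finset.Iio t) (s := Finset.univ.filter fun s => i s < p)
      fun s hs => by
        rw [Finset.mem_Iio]
        by_contra hts
        have h1 := hi (not_lt.1 hts)
        have h2 := (Finset.mem_filter.1 hs).2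
        omega
    rw [Fin.card_Iio] at this
    omega

theorem eq_of_wordContent_eq {n : ℕ} {i j : Fin n → ℕ} (hi : Monotone i) (hj : Monotone j)
    (h : wordContent i = wordContent j) : i = j := by
  funext t
  have key : ∀ p, i t < p ↔ j t < p := fun p => by
    rw [lt_iff_lt_sum_wordContent hi, lt_iff_lt_sum_wordContent hj, h]
  have h1 := key (i t + 1)
  have h2 := key (j t + 1)
  omega

theorem sum_range_le_degree (d : ℕ →₀ ℕ) (p : ℕ) : ∑ q ∈ Finset.range p, d q ≤ d.degree := by
  classical
  have h : ∑ q ∈ Finset.range p ∪ d.support, d q = d.degree :=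
    (Finset.sum_subset Finset.subset_union_right fun q _ hq => by simpa using hq).symm
  rw [← h]
  exact Finset.sum_le_sum_of_subset Finset.subset_union_left

theorem sum_range_eq_degree {d : ℕ →₀ ℕ} {p : ℕ} (h : ∀ q ∈ d.support, q < p) :
    ∑ q ∈ Finset.range p, d q = d.degree :=
  (Finset.sum_subset (fun q hq => Finset.mem_range.2 (h q hq)) fun q _ hq => by
    simpa using hq).symm

/-- Every exponent vector of degree `n` is the content of a weakly increasing word of length `n`:
its letter at `t` is the least `p` such that `t < d₀ + ⋯ + d_p`. -/
theorem exists_monotone_wordContent {n : ℕ} {d : ℕ →₀ ℕ} (hd : d.degree = n) :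
    ∃ i : Fin n → ℕ, Monotone i ∧ wordContent i = d := by
  have hmono : Monotone fun p => ∑ q ∈ Finset.range p, d q := fun a b hab =>
    Finset.sum_le_sum_of_subset (Finset.range_mono hab)
  have hex : ∀ t : Fin n, ∃ p, (t : ℕ) < ∑ q ∈ Finset.range (p + 1), d q := fun t => by
    refine ⟨d.support.sup id, ?_⟩
    rw [sum_range_eq_degree fun q hq => Nat.lt_succ_of_le (Finset.le_sup (f := id) hq), hd]
    exact t.2
  have hlt : ∀ t p, Nat.find (hex t) < p ↔ (t : ℕ) < ∑ q ∈ Finset.range p, d q := by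
    intro t p
    rw [Nat.find_lt_iff]
    constructor
    · rintro ⟨m, hm, h⟩
      exact h.trans_le (hmono hm)
    · intro h
      cases p with
      | zero => simp at h
      | succ m => exact ⟨m, Nat.lt_succ_self m, h⟩
  refine ⟨fun t => Nat.find (hex t), fun s t hst => ?_, ?_⟩
  · have h := (hlt t (Nat.find (hex t) + 1)).1 (Nat.lt_succ_self _)
    exact Nat.le_of_lt_succ ((hlt s _).2 (lt_of_le_of_lt hst h))
  · ext q
    have hle : ∑ r ∈ Finset.range (q + 1), d r ≤ n := hd ▸ sum_range_le_degree d (q + 1)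
    have hcard : ∀ p, ∑ r ∈ Finset.range p, wordContent (fun t => Nat.find (hex t)) r =
        ∑ r ∈ Finset.range p, d r := by
      intro p
      have hp : ∑ r ∈ Finset.range p, d r ≤ n := hd ▸ sum_range_le_degree d p
      rw [← card_filter_lt]
      simp only [hlt]
      rw [Fin.card_filter_val_lt, min_eq_right hp]
    have h1 := hcard (q + 1)
    rw [Finset.sum_range_succ, Finset.sum_range_succ, hcard q] at h1
    omega

/-- The words summed over in `F_I`: weakly increasing, and strictly increasing after the positions
in `I`. -/
def IsIncreasingWord {n : ℕ} (I : Set ℕ) (i : Fin n → ℕ) : Prop :=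
  Monotone i ∧ ∀ (j : ℕ) (h : j + 1 < n), j ∈ I → i ⟨j, by omega⟩ < i ⟨j + 1, h⟩

theorem isIncreasingWord_iff {n : ℕ} {I : Set ℕ} {i : Fin n → ℕ} :
    IsIncreasingWord I i ↔ ∀ (j : ℕ) (h : j + 1 < n),
      i ⟨j, by omega⟩ ≤ i ⟨j + 1, h⟩ ∧ (j ∈ I → i ⟨j, by omega⟩ < i ⟨j + 1, h⟩) := by
  constructor
  · rintro ⟨h1, h2⟩ j h
    exact ⟨h1 (by simp), h2 j h⟩
  · intro h
    refine ⟨?_, fun j hj => (h j hj).2⟩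
    cases n with
    | zero => intro a; exact a.elim0
    | succ n => exact Fin.monotone_iff_le_succ.2 fun t => (h t (by omega)).1

/-- A weakly increasing word increases strictly after position `j` exactly when `j + 1` is a
partial sum of its content. -/
theorem isIncreasingWord_iff_sum {n : ℕ} {I : Set ℕ} {i : Fin n → ℕ} (hi : Monotone i) :
    IsIncreasingWord I i ↔ ∀ j ∈ I, j + 1 < n →
      ∃ p, ∑ q ∈ Finset.range p, wordContent i q = j + 1 := by
  constructor
  · rintro ⟨-, h⟩ j hj hjn
    have h1 := (lt_iff_lt_sum_wordContent hi _ _).1 (h j hjn hj)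
    have h2 := (lt_iff_lt_sum_wordContent hi ⟨j + 1, hjn⟩ (i ⟨j + 1, hjn⟩)).not.1 (lt_irrefl _)
    simp only at h1 h2
    exact ⟨i ⟨j + 1, hjn⟩, by omega⟩
  · refine fun h => ⟨hi, fun j hjn hj => ?_⟩
    obtain ⟨p, hp⟩ := h j hj hjn
    have h1 := (lt_iff_lt_sum_wordContent hi ⟨j, by omega⟩ p).2 (by simp [hp])
    have h2 := (lt_iff_lt_sum_wordContent hi ⟨j + 1, hjn⟩ p).not.2 (by simp [hp])
    omega

/-- The words of length `n` and content `d`. -/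
def wordsOfContent (n : ℕ) (d : ℕ →₀ ℕ) : Finset (Fin n → ℕ) :=
  (Fintype.piFinset fun _ => d.support).filter fun i => wordContent i = d

theorem mem_wordsOfContent {n : ℕ} {d : ℕ →₀ ℕ} {i : Fin n → ℕ} :
    i ∈ wordsOfContent n d ↔ wordContent i = d := by
  simp only [wordsOfContent, Finset.mem_filter, Fintype.mem_piFinset, and_iff_right_iff_imp]
  rintro rfl t
  exact mem_support_wordContent i t

namespace QSym

open Classical in
theorem coeffL_F (n : ℕ) (I : Set ℕ) (d : ℕ →₀ ℕ) : coeffL d (F n I) =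
    (((wordsOfContent n d).filter (IsIncreasingWord I)).card : ℚ) := by
  refine congrArg (Nat.cast (R := ℚ)) ?_
  rw [← Nat.card_eq_finsetCard]
  exact Nat.card_congr
    { toFun := fun i => ⟨i.1.1, Finset.mem_filter.2 ⟨mem_wordsOfContent.2 i.2, i.1.2⟩⟩
      invFun := fun i => ⟨⟨i.1, (Finset.mem_filter.1 i.2).2⟩,
        mem_wordsOfContent.1 (Finset.mem_filter.1 i.2).1⟩
      left_inv := fun _ => rfl
      right_inv := fun _ => rfl }

open Classical in
/-- An exponent vector `d` occurs in `F_I` at most once: its only weakly increasing word has to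
increase strictly after the positions in `I`. -/
theorem coeffL_F_eq_ite (n : ℕ) (I : Set ℕ) (d : ℕ →₀ ℕ) : coeffL d (F n I) =
    if d.degree = n ∧ ∀ j ∈ I, j + 1 < n → ∃ p, ∑ q ∈ Finset.range p, d q = j + 1
      then 1 else 0 := by
  rw [coeffL_F]
  split_ifs with h
  · obtain ⟨i, hi, rfl⟩ := exists_monotone_wordContent h.1
    rw [Nat.cast_eq_one, Finset.card_eq_one]
    refine ⟨i, Finset.eq_singleton_iff_unique_mem.2 ⟨Finset.mem_filter.2
      ⟨mem_wordsOfContent.2 rfl, (isIncreasingWord_iff_sum hi).2 h.2⟩, fun j hj => ?_⟩⟩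
    obtain ⟨h1, h2⟩ := Finset.mem_filter.1 hj
    exact eq_of_wordContent_eq h2.1 hi (mem_wordsOfContent.1 h1)
  · rw [Nat.cast_eq_zero, Finset.card_eq_zero, Finset.filter_eq_empty_iff]
    intro i h1 h2
    rw [mem_wordsOfContent] at h1
    subst h1
    exact h ⟨degree_wordContent i, (isIncreasingWord_iff_sum h2.1).1 h2⟩

theorem ext_coeffL {f g : QSym} (h : ∀ d, coeffL d f = coeffL d g) : f = g :=
  ext_packed fun _ => h _

theorem F_zero (I : Set ℕ) : F 0 I = 1 := by
  classical
  refine ext_coeffL fun d => ?_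
  rw [coeffL_F_eq_ite]
  refine Eq.trans ?_ (MvPowerSeries.coeff_one (R := ℚ) (n := d)).symm
  simp [Finsupp.degree_eq_zero_iff]

theorem counit_F {n : ℕ} (hn : n ≠ 0) (I : Set ℕ) : Coalgebra.counit (R := ℚ) (F n I) = 0 := by
  change coeffL 0 (F n I) = 0
  rw [coeffL_F_eq_ite, if_neg]
  rintro ⟨h, -⟩
  exact hn (by simpa using h.symm)

/-! ### The comultiplication and the antipode of the fundamental quasisymmetric functions -/

/-- `Δ(F_I)` cuts the words of `F_I` into a prefix and a suffix. -/
theorem comul_F (n : ℕ) (I : Set ℕ) : Coalgebra.comul (R := ℚ) (F n I) =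
    ∑ k ∈ Finset.range (n + 1), F k I ⊗ₜ[ℚ] F (n - k) {j | j + k ∈ I} := by
  classical
  refine ext₂ fun d e => ?_
  obtain ⟨N, hN⟩ : ∃ N, ∀ q ∈ d.support, q < N :=
    ⟨d.support.sup id + 1, fun q hq => Nat.lt_succ_of_le (Finset.le_sup (f := id) hq)⟩
  have hinj : Function.Injective (fun x : ℕ => x + N) := add_left_injective N
  have hlow : ∀ p ≤ N, ∑ q ∈ Finset.range p, (d + e.mapDomain (· + N)) q =
      ∑ q ∈ Finset.range p, d q := fun p hp => Finset.sum_congr rfl fun q hq => by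
    rw [Finsupp.add_apply, Finsupp.mapDomain_of_notMem_range, add_zero]
    rintro ⟨y, hy⟩
    have := Finset.mem_range.1 hq
    simp only at hy
    omega
  have hhigh : ∀ p, ∑ q ∈ Finset.range (N + p), (d + e.mapDomain (· + N)) q =
      d.degree + ∑ q ∈ Finset.range p, e q := fun p => by
    rw [Finset.sum_range_add, hlow N le_rfl, sum_range_eq_degree hN]
    congr 1
    refine Finset.sum_congr rfl fun q _ => ?_
    have hd : d (N + q) = 0 := by
      by_contra hc
      have := hN _ (Finsupp.mem_support_iff.2 hc)
      omega
    rw [Finsupp.add_apply, hd, zero_add, add_comm N q]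
    exact Finsupp.mapDomain_apply hinj e q
  have hdeg : (d + e.mapDomain (· + N)).degree = d.degree + e.degree := by
    rw [map_add, Finsupp.degree_mapDomain]
  rw [coeffL₂_comul N d e hN, map_sum]
  simp only [coeffL₂_tmul, coeffL_F_eq_ite, hdeg]
  by_cases hn : d.degree + e.degree = n
  swap
  · rw [if_neg fun h => hn h.1, Finset.sum_eq_zero]
    intro k hk
    have := Finset.mem_range.1 hk
    by_cases hk' : d.degree = k
    · refine mul_eq_zero_of_right _ (if_neg fun h => hn ?_)
      omega
    · rw [if_neg fun h => hk' h.1, zero_mul]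
  rw [Finset.sum_eq_single d.degree]
  · rw [ite_zero_mul_ite_zero, mul_one]
    congr 1
    refine propext ⟨fun ⟨_, h⟩ => ⟨⟨rfl, fun j hj hjk => ?_⟩, by omega, fun j hj hjk => ?_⟩,
      fun ⟨⟨_, h1⟩, _, h2⟩ => ⟨hn, fun j hj hjn => ?_⟩⟩
    · obtain ⟨p, hp⟩ := h j hj (by omega)
      by_cases hpN : p ≤ N
      · exact ⟨p, by rw [← hp, hlow p hpN]⟩
      · obtain ⟨r, rfl⟩ := Nat.exists_eq_add_of_le (not_le.1 hpN).le
        rw [hhigh] at hp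
        omega
    · obtain ⟨p, hp⟩ := h (j + d.degree) hj (by omega)
      by_cases hpN : p ≤ N
      · have := sum_range_le_degree d p
        rw [hlow p hpN] at hp
        omega
      · obtain ⟨r, rfl⟩ := Nat.exists_eq_add_of_le (not_le.1 hpN).le
        rw [hhigh] at hp
        exact ⟨r, by omega⟩
    · rcases lt_trichotomy (j + 1) d.degree with hlt | heq | hgt
      · obtain ⟨p, hp⟩ := h1 j hj hlt
        by_cases hpN : p ≤ N
        · exact ⟨p, by rw [hlow p hpN, hp]⟩
        · rw [sum_range_eq_degree fun q hq => (hN q hq).trans (not_le.1 hpN)] at hp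
          omega
      · exact ⟨N, by rw [hlow N le_rfl, sum_range_eq_degree hN, heq]⟩
      · obtain ⟨p, hp⟩ := h2 (j - d.degree)
          (by rwa [Set.mem_ofPred_eq, Nat.sub_add_cancel (by omega)]) (by omega)
        exact ⟨N + p, by rw [hhigh, hp]; omega⟩
  · intro k _ hk
    rw [if_neg fun h => hk h.1.symm, zero_mul]
  · intro h
    exact absurd (Finset.mem_range.2 (by omega)) h

end QSym

open Classical in
/-- Cut a word of length `n` after `k` letters so that the adjacent pairs of the prefix satisfy `P`
and those of the suffix violate it. The pair astride the cut is free, so that the admissible cuts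
come in pairs `k`, `k + 1`, and their alternating sum vanishes. -/
theorem sum_neg_one_pow_cuts (P : ℕ → Prop) {n : ℕ} (hn : n ≠ 0) :
    ∑ k ∈ Finset.range (n + 1), (if (∀ j, j + 1 < k → P j) ∧
      (∀ j, k ≤ j → j + 1 < n → ¬ P j) then (-1 : ℚ) ^ k else 0) = 0 := by
  induction n with
  | zero => exact absurd rfl hn
  | succ n ih =>
    by_cases hn0 : n = 0
    · subst hn0
      rw [Finset.sum_range_succ, Finset.sum_range_one, if_pos, if_pos]
      · norm_num
      · exact ⟨fun j hj => by omega, fun j _ hj => by omega⟩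
      · exact ⟨fun j hj => by omega, fun j _ hj => by omega⟩
    by_cases hP : P (n - 1)
    · -- The cut lies after the last pair or astride it.
      rw [Finset.sum_range_succ, Finset.sum_range_succ, Finset.sum_eq_zero, zero_add]
      · have h : ((∀ j, j + 1 < n → P j) ∧ ∀ j, n ≤ j → j + 1 < n + 1 → ¬ P j) ↔
            ((∀ j, j + 1 < n + 1 → P j) ∧ ∀ j, n + 1 ≤ j → j + 1 < n + 1 → ¬ P j) := by
          constructor
          · rintro ⟨h, -⟩
            refine ⟨fun j hj => ?_, fun j hj hj' => by omega⟩
            by_cases hjn : j = n - 1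
            · rwa [hjn]
            · exact h j (by omega)
          · rintro ⟨h, -⟩
            exact ⟨fun j hj => h j (by omega), fun j hj hj' => by omega⟩
        simp only [h]
        split_ifs
        · rw [pow_succ]; ring
        · rw [add_zero]
      · intro k hk
        have := Finset.mem_range.1 hk
        exact if_neg fun h => h.2 (n - 1) (by omega) (by omega) hP
    · -- The last pair belongs to the suffix or is astride the cut.
      rw [Finset.sum_range_succ, if_neg fun h => hP (h.1 (n - 1) (by omega)), add_zero]
      refine Eq.trans (Finset.sum_congr rfl fun k hk => ?_) (ih hn0)
      have := Finset.mem_range.1 hk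
      congr 1
      refine propext ⟨fun h => ⟨h.1, fun j hj hj' => h.2 j hj (by omega)⟩,
        fun h => ⟨h.1, fun j hj hj' => ?_⟩⟩
      by_cases hjn : j = n - 1
      · rwa [hjn]
      · exact h.2 j hj (by omega)

/-- The complement of `I` in the set `{0, …, n - 2}` of inner positions, reversed. -/
def reverseCompl (n : ℕ) (I : Set ℕ) : Set ℕ := {j | n - 2 - j ∉ I}

/-- The word `w` steps down at position `j`: strictly if `j ∉ I`, weakly if `j ∈ I`. -/
def StepsDown {n : ℕ} (I : Set ℕ) (w : Fin n → ℕ) (j : ℕ) : Prop :=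
  ∃ h : j + 1 < n, w ⟨j + 1, h⟩ ≤ w ⟨j, by omega⟩ ∧ (j ∉ I → w ⟨j + 1, h⟩ < w ⟨j, by omega⟩)

theorem not_stepsDown {n : ℕ} {I : Set ℕ} {w : Fin n → ℕ} {j : ℕ} (h : j + 1 < n) :
    ¬ StepsDown I w j ↔
      w ⟨j, by omega⟩ ≤ w ⟨j + 1, h⟩ ∧ (j ∈ I → w ⟨j, by omega⟩ < w ⟨j + 1, h⟩) := by
  by_cases hj : j ∈ I <;> simp [StepsDown, h, hj] <;> omega

/-- A word of length `n` as its first `k` letters, read backwards, and the remaining ones. -/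
def cutWord {n k : ℕ} (hk : k ≤ n) : (Fin n → ℕ) ≃ (Fin k → ℕ) × (Fin (n - k) → ℕ) where
  toFun w := (fun t => w ⟨k - 1 - t, by omega⟩, fun t => w ⟨t + k, by omega⟩)
  invFun p t := if h : (t : ℕ) < k then p.1 ⟨k - 1 - t, by omega⟩ else p.2 ⟨t - k, by omega⟩
  left_inv w := by
    funext t
    by_cases h : (t : ℕ) < k
    · simp only [h, dif_pos]
      congr 1
      ext
      simp only
      omega
    · simp only [h, dif_neg, not_false_eq_true]
      congr 1
      ext
      simp only
      omega
  right_inv p := by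
    refine Prod.ext (funext fun t => ?_) (funext fun t => ?_)
    · have ht := t.2
      have h : k - 1 - (t : ℕ) < k := by omega
      simp only [h, dif_pos]
      exact congrArg p.1 (Fin.ext (by simp only; omega))
    · simp

theorem wordContent_cutWord {n k : ℕ} (hk : k ≤ n) (w : Fin n → ℕ) :
    wordContent (cutWord hk w).1 + wordContent (cutWord hk w).2 = wordContent w := by
  obtain ⟨m, rfl⟩ := Nat.exists_eq_add_of_le hk
  have h2 : wordContent (cutWord hk w).2 =
      ∑ t : Fin m, Finsupp.single (w (Fin.natAdd k t)) 1 := by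
    refine Fintype.sum_equiv (finCongr (by omega)) _ _ fun t => ?_
    simp only [cutWord, Equiv.coe_fn_mk]
    congr 2
    ext
    simp [add_comm]
  have h1 : wordContent (cutWord hk w).1 =
      ∑ t : Fin k, Finsupp.single (w (Fin.castAdd m t)) 1 := by
    refine Fintype.sum_equiv Fin.revPerm _ _ fun t => ?_
    simp only [cutWord, Equiv.coe_fn_mk]
    congr 2
    ext
    simp
    omega
  rw [h1, h2, wordContent, Fin.sum_univ_add]

/-- The prefix, read backwards, and the suffix are summation words of the two factors exactly when
the word steps down throughout the prefix and up throughout the suffix. -/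
theorem isIncreasingWord_cutWord {n k : ℕ} (hk : k ≤ n) (I : Set ℕ) (w : Fin n → ℕ) :
    IsIncreasingWord (reverseCompl k I) (cutWord hk w).1 ∧
      IsIncreasingWord {j | j + k ∈ I} (cutWord hk w).2 ↔
    (∀ j, j + 1 < k → StepsDown I w j) ∧ (∀ j, k ≤ j → j + 1 < n → ¬ StepsDown I w j) := by
  rw [isIncreasingWord_iff, isIncreasingWord_iff]
  refine and_congr ⟨fun h j hj => ?_, fun h j hj => ?_⟩ ⟨fun h j hj hjn => ?_, fun h j hj => ?_⟩
  · have h' := h (k - 2 - j) (by omega)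
    have e1 : k - 2 - (k - 2 - j) = j := by omega
    have e2 : k - 1 - (k - 2 - j) = j + 1 := by omega
    have e3 : k - 1 - (k - 2 - j + 1) = j := by omega
    simp only [cutWord, Equiv.coe_fn_mk, reverseCompl, Set.mem_ofPred_eq, e1, e2, e3] at h'
    exact ⟨by omega, h'⟩
  · obtain ⟨_, h'⟩ := h (k - 2 - j) (by omega)
    have e2 : k - 1 - j = k - 2 - j + 1 := by omega
    have e3 : k - 1 - (j + 1) = k - 2 - j := by omega
    simpa only [cutWord, Equiv.coe_fn_mk, reverseCompl, Set.mem_ofPred_eq, e2, e3] using h'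
  · rw [not_stepsDown hjn]
    have h' := h (j - k) (by omega)
    have e1 : j - k + k = j := by omega
    have e2 : j - k + 1 + k = j + 1 := by omega
    simpa only [cutWord, Equiv.coe_fn_mk, Set.mem_ofPred_eq, e1, e2] using h'
  · have h' := (not_stepsDown (by omega)).1 (h (j + k) (by omega) (by omega))
    have e2 : j + 1 + k = j + k + 1 := by omega
    simpa only [cutWord, Equiv.coe_fn_mk, Set.mem_ofPred_eq, e2] using h'

namespace QSym

open Classical in
theorem coeffL_F_mul_F {n k : ℕ} (hk : k ≤ n) (I : Set ℕ) (d : ℕ →₀ ℕ) :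
    coeffL d (F k (reverseCompl k I) * F (n - k) {j | j + k ∈ I}) =
      (((wordsOfContent n d).filter fun w => (∀ j, j + 1 < k → StepsDown I w j) ∧
        ∀ j, k ≤ j → j + 1 < n → ¬ StepsDown I w j).card : ℚ) := by
  rw [coeffL_mul]
  simp only [coeffL_F, ← Nat.cast_mul, ← Nat.cast_sum, ← Finset.card_product]
  rw [← Finset.card_sigma]
  congr 1
  symm
  refine Finset.card_bij' (fun w _ => ⟨(wordContent (cutWord hk w).1,
    wordContent (cutWord hk w).2), cutWord hk w⟩) (fun p _ => (cutWord hk).symm p.2) ?_ ?_ ?_ ?_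
  · intro w hw
    obtain ⟨h1, h2⟩ := Finset.mem_filter.1 hw
    rw [mem_wordsOfContent] at h1
    rw [← isIncreasingWord_cutWord hk] at h2
    simp only [Finset.mem_sigma, Finset.HasAntidiagonal.mem_antidiagonal, Finset.mem_product,
      Finset.mem_filter, mem_wordsOfContent, wordContent_cutWord, true_and]
    exact ⟨h1, h2⟩
  · rintro ⟨⟨a, b⟩, p⟩ hp
    simp only [Finset.mem_sigma, Finset.HasAntidiagonal.mem_antidiagonal, Finset.mem_product,
      Finset.mem_filter, mem_wordsOfContent] at hp
    rw [Finset.mem_filter, mem_wordsOfContent, ← isIncreasingWord_cutWord hk,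
      ← wordContent_cutWord hk, Equiv.apply_symm_apply]
    obtain ⟨h1, ⟨h2, h3⟩, h4, h5⟩ := hp
    exact ⟨by rw [h2, h4, h1], h3, h5⟩
  · intro w _
    exact Equiv.symm_apply_apply _ _
  · rintro ⟨⟨a, b⟩, p⟩ hp
    simp only [Finset.mem_sigma, Finset.HasAntidiagonal.mem_antidiagonal, Finset.mem_product,
      Finset.mem_filter, mem_wordsOfContent] at hp
    obtain ⟨h1, ⟨h2, h3⟩, h4, h5⟩ := hp
    simp only [Equiv.apply_symm_apply, h2, h4]

theorem sum_neg_one_pow_F_mul_F {n : ℕ} (hn : n ≠ 0) (I : Set ℕ) :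
    ∑ k ∈ Finset.range (n + 1),
      (-1 : ℚ) ^ k • (F k (reverseCompl k I) * F (n - k) {j | j + k ∈ I}) = 0 := by
  classical
  refine ext_coeffL fun d => ?_
  rw [map_sum, map_zero]
  calc _ = ∑ k ∈ Finset.range (n + 1), ∑ w ∈ wordsOfContent n d,
        if (∀ j, j + 1 < k → StepsDown I w j) ∧
          (∀ j, k ≤ j → j + 1 < n → ¬ StepsDown I w j) then (-1 : ℚ) ^ k else 0 := by
        refine Finset.sum_congr rfl fun k hk => ?_
        rw [map_smul, coeffL_F_mul_F (Nat.le_of_lt_succ (Finset.mem_range.1 hk)),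
          ← Finset.sum_filter, Finset.sum_const, nsmul_eq_mul, smul_eq_mul, mul_comm]
    _ = 0 := by
        rw [Finset.sum_comm]
        exact Finset.sum_eq_zero fun w _ => sum_neg_one_pow_cuts _ hn

/-- `S(F_I) = (-1)ⁿ F_J`, where `J` is the reversed complement of `I`: both sides satisfy the
recursion that makes `S` a convolution inverse of the identity. -/
theorem antipode_F (n : ℕ) (I : Set ℕ) :
    HopfAlgebra.antipode ℚ (F n I) = (-1 : ℚ) ^ n • F n (reverseCompl n I) := by
  induction n using Nat.strong_induction_on generalizing I with
  | _ n ih =>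
    by_cases hn : n = 0
    · subst hn
      rw [F_zero, F_zero, HopfAlgebra.antipode_one, pow_zero, one_smul]
    · have h1 := LinearMap.congr_fun (HopfAlgebra.mul_antipode_rTensor_comul (R := ℚ) (A := QSym))
        (F n I)
      simp only [LinearMap.coe_comp, Function.comp_apply, comul_F, map_sum, counit_F hn,
        LinearMap.rTensor_tmul, LinearMap.mul'_apply, map_zero] at h1
      have h2 := sum_neg_one_pow_F_mul_F hn I
      rw [Finset.sum_range_succ] at h1 h2
      rw [Finset.sum_congr rfl fun k hk => by rw [ih k (Finset.mem_range.1 hk), smul_mul_assoc]]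
        at h1
      have h3 := add_left_cancel (h1.trans h2.symm)
      rwa [Nat.sub_self, F_zero, mul_one, mul_one] at h3

end QSym

/-! ### Reversing the blocks of a weakly increasing word -/

/-- The involution of the positions of a weakly increasing word `i` which reverses every maximal
block of equal letters: if the block of `t` is `{a, …, b}`, where `a` is the number of smaller
letters and `b + 1` the number of letters that are at most `i t`, then `t ↦ a + b - t`. -/
def blockReverse {n : ℕ} {i : Fin n → ℕ} (hi : Monotone i) : Fin n ≃ Fin n :=
  have key : ∀ t : Fin n, ∀ s : ℕ, s = ∑ q ∈ Finset.range (i t), wordContent i q +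
      ∑ q ∈ Finset.range (i t + 1), wordContent i q - 1 - t → ∃ h : s < n, i ⟨s, h⟩ = i t := by
    intro t s hs
    have h1 := (lt_iff_lt_sum_wordContent hi t (i t)).not.1 (lt_irrefl _)
    have h2 := (lt_iff_lt_sum_wordContent hi t (i t + 1)).1 (Nat.lt_succ_self _)
    have h3 := sum_range_le_degree (wordContent i) (i t + 1)
    rw [degree_wordContent] at h3
    have h : s < n := by omega
    have h4 := (lt_iff_lt_sum_wordContent hi ⟨s, h⟩ (i t)).not.2 (by simp only; omega)
    have h5 := (lt_iff_lt_sum_wordContent hi ⟨s, h⟩ (i t + 1)).2 (by simp only; omega)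
    exact ⟨h, by omega⟩
  Function.Involutive.toPerm (fun t => ⟨∑ q ∈ Finset.range (i t), wordContent i q +
      ∑ q ∈ Finset.range (i t + 1), wordContent i q - 1 - t, (key t _ rfl).1⟩) fun t => by
    obtain ⟨h, e⟩ := key t _ rfl
    have h1 := (lt_iff_lt_sum_wordContent hi t (i t)).not.1 (lt_irrefl _)
    have h2 := (lt_iff_lt_sum_wordContent hi t (i t + 1)).1 (Nat.lt_succ_self _)
    ext
    simp only [e]
    omega

theorem blockReverse_val {n : ℕ} {i : Fin n → ℕ} (hi : Monotone i) (t : Fin n) :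
    (blockReverse hi t : ℕ) = ∑ q ∈ Finset.range (i t), wordContent i q +
      ∑ q ∈ Finset.range (i t + 1), wordContent i q - 1 - t := rfl

theorem apply_blockReverse {n : ℕ} {i : Fin n → ℕ} (hi : Monotone i) (t : Fin n) :
    i (blockReverse hi t) = i t := by
  have h1 := (lt_iff_lt_sum_wordContent hi t (i t)).not.1 (lt_irrefl _)
  have h2 := (lt_iff_lt_sum_wordContent hi t (i t + 1)).1 (Nat.lt_succ_self _)
  have h3 := blockReverse_val hi t
  have h4 := (lt_iff_lt_sum_wordContent hi (blockReverse hi t) (i t)).not.2 (by omega)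
  have h5 := (lt_iff_lt_sum_wordContent hi (blockReverse hi t) (i t + 1)).2 (by omega)
  omega

theorem blockReverse_val_succ {n : ℕ} {i : Fin n → ℕ} (hi : Monotone i) {s t : Fin n}
    (hst : (t : ℕ) = s + 1) (h : i s = i t) :
    (blockReverse hi s : ℕ) = blockReverse hi t + 1 := by
  have h2 := (lt_iff_lt_sum_wordContent hi t (i t + 1)).1 (Nat.lt_succ_self _)
  rw [blockReverse_val, blockReverse_val, h]
  omega

namespace Digraph

variable {V : Type*}

/-- Let the edges of `Y` be reversed edges of `X`. If no edge of `X` joins consecutive positions inside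
a block of `i`, then no edge of `Y` does so after the blocks of the listing have been reversed. -/
theorem isIncreasingWord_desSet_blockReverse {n : ℕ} {X Y : Digraph V} {i : Fin n → ℕ}
    (hi : Monotone i) {σ : Fin n → V} (hσ : Function.Injective σ)
    (hXY : ∀ u v, u ≠ v → Y.Adj u v → X.Adj v u) (h : IsIncreasingWord (X.desSet σ) i) :
    IsIncreasingWord (Y.desSet (σ ∘ blockReverse hi)) i := by
  refine ⟨hi, fun j hj => ?_⟩
  rintro ⟨_, hadj⟩
  refine (hi (Fin.mk_le_mk.2 j.le_succ)).lt_of_ne fun hne => ?_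
  have hval := blockReverse_val_succ hi (s := ⟨j, by omega⟩) (t := ⟨j + 1, hj⟩) rfl hne
  set r := blockReverse hi ⟨j + 1, hj⟩ with hr
  have hs : blockReverse hi ⟨j, by omega⟩ = ⟨r + 1, by omega⟩ := Fin.ext hval
  have hX : X.Adj (σ r) (σ ⟨r + 1, by omega⟩) := by
    refine hXY _ _ (hσ.ne ?_) ?_
    · intro hc
      have := congrArg Fin.val hc
      simp at this
    · rw [← hs, hr]
      exact hadj
  have hlt := h.2 r (by omega) ⟨by omega, hX⟩
  have e1 : i r = i ⟨j + 1, hj⟩ := apply_blockReverse hi _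
  have e2 : i ⟨r + 1, by omega⟩ = i ⟨j, by omega⟩ := by rw [← hs]; exact apply_blockReverse hi _
  exact lt_irrefl _ (hlt.trans_eq (e2.trans (hne.trans e1.symm)))

open Classical in
theorem coeffL_redeiBerge [Fintype V] (X : Digraph V) (d : ℕ →₀ ℕ) :
    QSym.coeffL d X.redeiBerge = ∑ i ∈ wordsOfContent (Fintype.card V) d,
      ((Finset.univ.filter fun σ : Fin (Fintype.card V) ≃ V =>
        IsIncreasingWord (X.desSet σ) i).card : ℚ) := by
  simp only [redeiBerge, map_sum, QSym.coeffL_F, Finset.card_filter, Nat.cast_sum]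
  exact Finset.sum_comm

open Classical in
theorem card_isIncreasingWord_le [Fintype V] {X Y : Digraph V}
    (hXY : ∀ u v, u ≠ v → Y.Adj u v → X.Adj v u) (i : Fin (Fintype.card V) → ℕ) :
    (Finset.univ.filter fun σ : Fin (Fintype.card V) ≃ V =>
        IsIncreasingWord (X.desSet σ) i).card ≤
      (Finset.univ.filter fun σ : Fin (Fintype.card V) ≃ V =>
        IsIncreasingWord (Y.desSet σ) i).card := by
  by_cases hi : Monotone i
  · refine Finset.card_le_card_of_injOn (fun σ => (blockReverse hi).trans σ) ?_ ?_
    · intro σ hσ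
      simp only [Finset.coe_filter, Finset.mem_univ, true_and, Set.mem_ofPred_eq] at hσ ⊢
      exact isIncreasingWord_desSet_blockReverse hi σ.injective hXY hσ
    · intro σ _ τ _ h
      refine Equiv.ext fun t => ?_
      simpa using Equiv.congr_fun h ((blockReverse hi).symm t)
  · rw [Finset.filter_false_of_mem fun σ _ h => hi h.1]
    simp

/-- `U_X` does not change when all edges are reversed; loops do not matter. -/
theorem redeiBerge_eq_of_adj_iff_swap [Fintype V] {X Y : Digraph V}
    (hXY : ∀ u v, u ≠ v → (Y.Adj u v ↔ X.Adj v u)) : X.redeiBerge = Y.redeiBerge := by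
  refine QSym.ext_coeffL fun d => ?_
  rw [coeffL_redeiBerge, coeffL_redeiBerge]
  refine Finset.sum_congr rfl fun i _ => ?_
  rw [le_antisymm (card_isIncreasingWord_le (fun u v h => (hXY u v h).1) i)
    (card_isIncreasingWord_le (fun u v h => (hXY v u h.symm).2) i)]

/-! ### The antipode of `U_X` -/

/-- Reading a listing backwards reverses its descent set and passes to the opposite digraph; the
complement of the descent set belongs to the complementary digraph. For a tournament, the opposite
of the complementary digraph is `X` itself. -/
theorem isIncreasingWord_reverseCompl_desSet {n : ℕ} {X : Digraph V} (hX : X.IsTournament)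
    (σ : Fin n ≃ V) (i : Fin n → ℕ) :
    IsIncreasingWord (reverseCompl n (X.desSet σ)) i ↔
      IsIncreasingWord (X.desSet (Fin.revPerm.trans σ)) i := by
  have key : ∀ j, j + 1 < n →
      (j ∈ reverseCompl n (X.desSet σ) ↔ j ∈ X.desSet (Fin.revPerm.trans σ)) := by
    intro j hj
    have e : (Fin.rev ⟨j, by omega⟩ : Fin n) = ⟨n - 2 - j + 1, by omega⟩ :=
      Fin.ext (by simp; omega)
    have e' : (Fin.rev ⟨j + 1, hj⟩ : Fin n) = ⟨n - 2 - j, by omega⟩ := Fin.ext (by simp; omega)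
    have hne : σ ⟨n - 2 - j + 1, by omega⟩ ≠ σ ⟨n - 2 - j, by omega⟩ :=
      σ.injective.ne (by simp)
    simp only [reverseCompl, desSet, Set.mem_ofPred_eq, Equiv.trans_apply, Fin.revPerm_apply, e,
      e', hj, exists_true_left, hX.2 _ _ hne]
    exact not_congr ⟨fun ⟨_, h⟩ => h, fun h => ⟨by omega, h⟩⟩
  exact and_congr_right fun _ => forall₂_congr fun j hj => by rw [key j hj]

theorem antipode_redeiBerge [Fintype V] {X : Digraph V} (hX : X.IsTournament) :
    HopfAlgebra.antipode ℚ X.redeiBerge = (-1 : ℚ) ^ Fintype.card V • X.redeiBerge := by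
  classical
  have h : ∑ σ : Fin (Fintype.card V) ≃ V,
      QSym.F (Fintype.card V) (reverseCompl (Fintype.card V) (X.desSet σ)) = X.redeiBerge := by
    refine Fintype.sum_equiv (Equiv.equivCongr Fin.revPerm (Equiv.refl V)) _ _ fun σ => ?_
    refine QSym.ext_coeffL fun d => ?_
    rw [QSym.coeffL_F, QSym.coeffL_F]
    congr 2
    exact Finset.filter_congr fun i _ => isIncreasingWord_reverseCompl_desSet hX σ i
  rw [← h, Finset.smul_sum, h, redeiBerge, map_sum]
  exact Finset.sum_congr rfl fun σ _ => QSym.antipode_F _ _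

end Digraph

/-! ### The principal specialization and the antipode -/

namespace QSym

/-- For `f` of degree at most `N`, the sum defining `evalOnes m f` may be taken over the box of the
exponent vectors in the first `m` variables with all exponents at most `N`. -/
theorem evalOnes_eq_sum {m N : ℕ} {f : QSym} (hf : ∀ d : ℕ →₀ ℕ, N < d.degree → coeffL d f = 0) :
    evalOnes m f =
      ∑ d ∈ Finset.Iic (∑ p ∈ Finset.range m, Finsupp.single p N), coeffL d f := by
  refine finsum_mem_eq_sum_of_inter_support_eq _ (Set.ext fun d => ?_)
  simp only [Set.mem_inter_iff, Set.mem_ofPred_eq, Function.mem_support, Finset.coe_Iic,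
    Set.mem_Iic, ← coeffL_apply]
  have key : ∀ q, (∑ p ∈ Finset.range m, Finsupp.single p N) q = if q < m then N else 0 :=
    fun q => by simp [Finsupp.finsetSum_apply, Finsupp.single_apply]
  refine and_congr_left fun hd => ⟨fun h q => ?_, fun h q hq => ?_⟩
  · rw [key]
    split_ifs with hq
    · have : d q ≤ d.degree := Finsupp.le_degree q d
      have : ¬ N < d.degree := fun hc => hd (hf d hc)
      omega
    · refine (Finsupp.notMem_support_iff.1 fun hc => hq ?_).le
      exact Finset.mem_range.1 (h hc)
  · have := h q
    rw [key] at this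
    rw [Finset.mem_range]
    by_contra hc
    rw [if_neg hc] at this
    exact Finsupp.mem_support_iff.1 hq (by omega)

theorem evalOnes_mul (m : ℕ) (f g : QSym) : evalOnes m (f * g) = evalOnes m f * evalOnes m g := by
  classical
  obtain ⟨N, hN⟩ := f.2.1
  obtain ⟨K, hK⟩ := g.2.1
  have hf : ∀ d : ℕ →₀ ℕ, N < d.degree → coeffL d f = 0 := hN
  have hg : ∀ d : ℕ →₀ ℕ, K < d.degree → coeffL d g = 0 := hK
  have hfg : ∀ d e : ℕ →₀ ℕ, N + K < (d + e).degree → coeffL d f * coeffL e g = 0 := by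
    intro d e h
    rw [map_add] at h
    by_cases hd : N < d.degree
    · rw [hf d hd, zero_mul]
    · rw [hg e (by omega), mul_zero]
  rw [evalOnes_eq_sum (N := N + K) (f := f * g), evalOnes_eq_sum (N := N + K) (f := f),
    evalOnes_eq_sum (N := N + K) (f := g), Finset.sum_mul_sum, ← Finset.sum_product']
  · simp only [coeffL_mul]
    rw [Finset.sum_sigma']
    set B : ℕ →₀ ℕ := ∑ p ∈ Finset.range m, Finsupp.single p (N + K) with hB
    have key : ∀ q, B q = if q < m then N + K else 0 := fun q => by
      simp only [hB, Finsupp.finsetSum_apply, Finsupp.single_apply, Finset.sum_ite_eq',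
        Finset.mem_range]
    -- A pair in the product of two boxes may have its sum outside the box, but its term is then zero
    -- because the degree of the sum exceeds `N + K`.
    refine Finset.sum_bij_ne_zero (fun s _ _ => s.2) ?_ ?_ ?_ ?_
    · rintro ⟨d, a, b⟩ h _
      simp only [Finset.mem_sigma, Finset.mem_Iic, Finset.HasAntidiagonal.mem_antidiagonal,
        Finset.mem_product] at h ⊢
      obtain ⟨h1, rfl⟩ := h
      exact ⟨le_self_add.trans h1, le_add_self.trans h1⟩
    · rintro ⟨d, p⟩ h _ ⟨e, q⟩ h' _ hpq
      simp only [Finset.mem_sigma, Finset.mem_Iic,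
        Finset.HasAntidiagonal.mem_antidiagonal] at h h' hpq
      subst hpq
      rw [← h.2, ← h'.2]
    · rintro ⟨a, b⟩ h hne
      simp only [Finset.mem_product, Finset.mem_Iic] at h
      refine ⟨⟨a + b, a, b⟩, ?_, hne, rfl⟩
      simp only [Finset.mem_sigma, Finset.mem_Iic, Finset.HasAntidiagonal.mem_antidiagonal,
        and_true]
      intro q
      have h1 := h.1 q
      have h2 := h.2 q
      have h3 : (a + b) q ≤ (a + b).degree := Finsupp.le_degree q _
      have h4 : ¬ N + K < (a + b).degree := fun hc => hne (hfg a b hc)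
      rw [key] at h1 h2 ⊢
      rw [Finsupp.add_apply] at h3 ⊢
      split_ifs at h1 h2 ⊢ <;> omega
    · intros; rfl
  · exact fun d hd => hg d (by omega)
  · exact fun d hd => hf d (by omega)
  · intro d hd
    rw [coeffL_mul]
    refine Finset.sum_eq_zero fun p hp => ?_
    rw [Finset.HasAntidiagonal.mem_antidiagonal] at hp
    exact hfg _ _ (hp ▸ hd)

theorem evalOnes_add (m : ℕ) (f g : QSym) : evalOnes m (f + g) = evalOnes m f + evalOnes m g := by
  simp only [evalOnes, Subalgebra.coe_add, map_add]
  exact finsum_mem_add_distrib' (finite_evalOnes m f) (finite_evalOnes m g)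

theorem evalOnes_smul (m : ℕ) (r : ℚ) (f : QSym) : evalOnes m (r • f) = r * evalOnes m f := by
  simp only [evalOnes, Subalgebra.coe_smul, map_smul, smul_eq_mul]
  exact (mul_finsum_mem _ r).symm

/-- `Φ ↦ Φ(1, …, 1, 0, 0, …)` with `m` ones, as a linear map. -/
def evalOnesL (m : ℕ) : QSym →ₗ[ℚ] ℚ where
  toFun := evalOnes m
  map_add' := evalOnes_add m
  map_smul' := evalOnes_smul m

theorem psOne_unique {f : QSym} {p : Polynomial ℚ}
    (h : ∀ m : ℕ, p.eval (m : ℚ) = evalOnes m f) : psOne f = p :=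
  (existsUnique_polynomial f).unique (psOne_eval f) h

/-- The principal specialization as a linear map. -/
def psOneL : QSym →ₗ[ℚ] Polynomial ℚ where
  toFun := psOne
  map_add' f g := psOne_unique fun m => by
    rw [Polynomial.eval_add, psOne_eval, psOne_eval, evalOnes_add]
  map_smul' r f := psOne_unique fun m => by
    rw [Polynomial.eval_smul, psOne_eval, evalOnes_smul, RingHom.id_apply, smul_eq_mul]

theorem psOne_M_eval (α : List ℕ+) (x : ℚ) : (psOne (M α)).eval x = Ring.choose x α.length := by
  have h : psOne (M α) =
      Polynomial.C ((α.length.factorial : ℚ)⁻¹) * descPochhammer ℚ α.length :=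
    psOne_unique fun m => by
      rw [evalOnes_M, Polynomial.eval_mul, Polynomial.eval_C,
        descPochhammer_eval_eq_descFactorial, Nat.descFactorial_eq_factorial_mul_choose,
        Nat.cast_mul, inv_mul_cancel_left₀ (by positivity)]
  rw [h, Polynomial.eval_mul, Polynomial.eval_C, Ring.choose_eq_smul, smul_eq_mul,
    descPochhammer_eval_eq_ascPochhammer, Polynomial.descPochhammer_smeval_eq_ascPochhammer,
    Polynomial.ascPochhammer_smeval_eq_eval]

/-- On `M_α` the recursion for the antipode turns into the Chu-Vandermonde identity
`∑ₖ C(-m, k) C(m, ℓ - k) = 0`. -/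
theorem evalOnes_antipodeM (m : ℕ) (α : List ℕ+) :
    evalOnes m (antipodeM α) = Ring.choose (-m : ℚ) α.length := by
  induction h : α.length using Nat.strong_induction_on generalizing α with
  | _ n ih =>
    by_cases hα : α = []
    · subst hα
      subst h
      rw [antipodeM_nil, ← M_nil, evalOnes_M]
      simp
    · have hn : n ≠ 0 := by rintro rfl; exact hα (List.length_eq_zero_iff.1 h)
      subst h
      have h1 : evalOnes m (antipodeM α) =
          -∑ k : Fin α.length, evalOnes m (antipodeM (α.take k)) * evalOnes m (M (α.drop k)) := by
        change evalOnesL m (antipodeM α) = _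
        rw [antipodeM_of_ne hα, map_neg, map_sum]
        congr 1
        exact Finset.sum_congr rfl fun k _ => evalOnes_mul m _ _
      have h2 := Ring.add_choose_eq α.length (Commute.all (-m : ℚ) (m : ℚ))
      rw [neg_add_cancel, Finset.Nat.sum_antidiagonal_eq_sum_range_succ
        (fun i j => Ring.choose (-m : ℚ) i * Ring.choose (m : ℚ) j), Finset.sum_range_succ,
        Nat.sub_self, Ring.choose_zero_right, mul_one, Ring.choose_zero_pos _ (Nat.pos_of_ne_zero hn),
        Finset.sum_range (n := α.length)] at h2
      rw [h1, eq_comm, ← add_eq_zero_iff_eq_neg, h2, add_comm]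
      congr 1
      refine Finset.sum_congr rfl fun k _ => ?_
      have hk : (α.take k).length = k := by simp
      rw [ih k k.2 _ hk, evalOnes_M, List.length_drop, Ring.choose_natCast]

/-- `ps¹(S(Φ))(m) = ps¹(Φ)(-m)`. -/
theorem psOne_eval_neg (f : QSym) (m : ℕ) :
    (psOne f).eval (-m : ℚ) = evalOnes m (HopfAlgebra.antipode ℚ f) := by
  have h : Polynomial.leval (-m : ℚ) ∘ₗ psOneL = evalOnesL m ∘ₗ HopfAlgebra.antipode ℚ := by
    refine hom_ext fun α => ?_
    change (psOne (M α)).eval (-m : ℚ) = evalOnes m (antipodeL (M α))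
    rw [psOne_M_eval, antipodeL_M, evalOnes_antipodeM]
  exact LinearMap.congr_fun h f

theorem psOne_eval_neg_of_antipode_eq_smul {f : QSym} {c : ℚ}
    (h : HopfAlgebra.antipode ℚ f = c • f) (x : ℚ) :
    (psOne f).eval (-x) = c * (psOne f).eval x := by
  have hp : (psOne f).comp (-Polynomial.X) = c • psOne f := by
    apply Polynomial.eq_of_infinite_eval_eq
    refine (Set.infinite_range_of_injective (Nat.cast_injective (R := ℚ))).mono ?_
    rintro _ ⟨m, rfl⟩
    simp only [Set.mem_ofPred_eq, Polynomial.eval_comp, Polynomial.eval_neg, Polynomial.eval_X,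
      Polynomial.eval_smul, smul_eq_mul]
    rw [psOne_eval_neg, h, evalOnes_smul, psOne_eval]
  simpa using congrArg (Polynomial.eval x) hp

end QSym

end

theorem mainTheorem8 {V : Type*} [Fintype V] (X : Digraph V) (hX : X.IsTournament) :
    X.redeiBerge = X.complementary.redeiBerge ∧
    HopfAlgebra.antipode ℚ X.redeiBerge = (-1 : ℚ) ^ Fintype.card V • X.redeiBerge ∧
    ∀ m : ℚ, X.redeiBergePoly.eval (-m) =
      (-1) ^ Fintype.card V * X.redeiBergePoly.eval m :=
  have hU : X.redeiBerge = X.complementary.redeiBerge :=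
    Digraph.redeiBerge_eq_of_adj_iff_swap fun u v huv =>
      ⟨fun h => (hX.2 v u huv.symm).2 h.2, fun h => ⟨huv, (hX.2 v u huv.symm).1 h⟩⟩
  ⟨hU, Digraph.antipode_redeiBerge hX,
    QSym.psOne_eval_neg_of_antipode_eq_smul (Digraph.antipode_redeiBerge hX)⟩
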